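/- Let $\mathbb{K}$ be $\mathbb{R}$ or $\mathbb{C}$; all spaces below consist of $\mathbb{K}$-valued functions on $\mathbb{R}$. For a positive continuous function $u$ on $\mathbb{R}$ and $n \in \mathbb{N} = \{0,1,2,\dots\}$, let $\mathscr{B}^n_u$ be the normed space of all $f \in C^n(\mathbb{R})$ with $$\|f\|_{u,n} = \max_{p \le n} \sup_{x \in \mathbb{R}} \frac{|f^{(p)}(x)|}{u(x)} < \infty .$$ For a continuous function $v : \mathbb{R} \to [1,\infty)$ set $$\mathscr{K}_v = \varprojlim_{N} \mathscr{B}^N_{1/v^N}, \qquad \mathscr{O}_{C,v} = \varinjlim_{N} \varprojlim_{n} \mathscr{B}^n_{v^N}, \qquad \mathscr{O}_{M,v} = \varprojlim_{n} \varinjlim_{N} \mathscr{B}^n_{v^N},$$ where $N, n$ range over $\mathbb{N}$, a projective limit is the intersection of the spaces with the coarsest topology making all inclusions into them continuous, and an inductive limit is the union of the spaces with the finest locally convex vector space topology making the inclusions of all of them continuous. For $\varphi : \mathbb{R} \to \mathbb{R}$ write $C_\varphi(f) = f \circ \varphi$. **Theorem.** Let $v, w : \mathbb{R} \to [1,\infty)$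 be continuous functions such that $$\sup_{x,t \in \mathbb{R},\, |t| \le 1} \frac{v(x+t)}{v^\lambda(x)} < \infty \qquad \text{and} \qquad \sup_{x,t \in \mathbb{R},\, |t| \le 1} \frac{w(x+t)}{w^\mu(x)} < \infty$$ for some $\lambda, \mu > 0$, and let $\varphi : \mathbb{R} \to \mathbb{R}$ be smooth. (I) The following are equivalent: (i) $C_\varphi(\mathscr{K}_v) \subseteq \mathscr{K}_w$; (ii) $C_\varphi : \mathscr{K}_v \to \mathscr{K}_w$ is well defined and continuous; (iii) there is $\lambda > 0$ with $\sup_{x} w(x)/v^\lambda(\varphi(x)) < \infty$, and for every integer $p \ge 1$ there is $\lambda > 0$ with $\sup_{x} |\varphi^{(p)}(x)|/v^\lambda(\varphi(x)) < \infty$. (II) The following are equivalent: (i) $C_\varphi(\mathscr{O}_{C,v}) \subseteq \mathscr{O}_{C,w}$; (ii) $C_\varphi : \mathscr{O}_{C,v} \to \mathscr{O}_{C,w}$ is well defined and continuous; (iii) there is $\mu > 0$ with $\sup_{x} v(\varphi(x))/w^\mu(x) < \infty$, and for all integers $p, k \ge 1$ one has $\sup_{x} |\varphi^{(p)}(x)|/w^{1/k}(x)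 < \infty$. (III) The following are equivalent: (i) $C_\varphi(\mathscr{O}_{M,v}) \subseteq \mathscr{O}_{M,w}$; (ii) $C_\varphi : \mathscr{O}_{M,v} \to \mathscr{O}_{M,w}$ is well defined and continuous; (iii) there is $\mu > 0$ with $\sup_{x} v(\varphi(x))/w^\mu(x) < \infty$, and for every integer $p \ge 1$ there is $\mu > 0$ with $\sup_{x} |\varphi^{(p)}(x)|/w^\mu(x) < \infty$. -/

import Mathlib

open scoped ContDiff

noncomputable section

namespace WeightedSmooth

/-- A positive continuous function on the real line. -/
structure Weight where
  /-- The underlying function. -/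
  toFun : ℝ → ℝ
  continuous_toFun : Continuous toFun
  pos : ∀ x, 0 < toFun x

namespace Weight

instance : CoeFun Weight (fun _ => ℝ → ℝ) := ⟨Weight.toFun⟩

/-- The pointwise power `v ^ N`. -/
instance : Pow Weight ℕ where
  pow v N := ⟨fun x => v x ^ N, v.continuous_toFun.pow N, fun x => pow_pos (v.pos x) N⟩

/-- The pointwise reciprocal `1 / v`. -/
instance : Inv Weight where
  inv v := ⟨fun x => (v x)⁻¹, v.continuous_toFun.inv₀ fun x => (v.pos x).ne',
    fun x => inv_pos.2 (v.pos x)⟩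

theorem pow_apply (v : Weight) (N : ℕ) (x : ℝ) : (v ^ N) x = v x ^ N := rfl

theorem inv_apply (v : Weight) (x : ℝ) : v⁻¹ x = (v x)⁻¹ := rfl

end Weight

/-- The vector space of all functions `ℝ → 𝕜`, as a type of its own that does not carry the
topology of pointwise convergence, so that its subspaces can be given their own topologies. -/
@[ext] structure Fun (𝕜 : Type*) where
  /-- The underlying function. Use the coercion instead. -/
  toFun : ℝ → 𝕜

namespace Fun

instance (𝕜 : Type*) : FunLike (Fun 𝕜) ℝ 𝕜 where
  coe := toFun
  coe_injective _ _ h := Fun.ext h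

/-- The obvious bijection between `Fun 𝕜` and `ℝ → 𝕜`. -/
def equiv (𝕜 : Type*) : Fun 𝕜 ≃ (ℝ → 𝕜) where
  toFun := toFun
  invFun := mk
  left_inv _ := rfl
  right_inv _ := rfl

variable {𝕜 : Type*} [RCLike 𝕜]

instance : AddCommGroup (Fun 𝕜) := (equiv 𝕜).addCommGroup

instance : Module 𝕜 (Fun 𝕜) := (equiv 𝕜).module 𝕜

instance : Module ℝ (Fun 𝕜) := (equiv 𝕜).module ℝ

theorem coe_zero : ⇑(0 : Fun 𝕜) = fun _ => 0 := rfl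

theorem coe_add (f g : Fun 𝕜) : ⇑(f + g) = ⇑f + ⇑g := rfl

theorem coe_smul (c : 𝕜) (f : Fun 𝕜) : ⇑(c • f) = c • ⇑f := rfl

theorem coe_real_smul (c : ℝ) (f : Fun 𝕜) : ⇑(c • f) = c • ⇑f := rfl

instance : IsScalarTower ℝ 𝕜 (Fun 𝕜) where
  smul_assoc a b f := DFunLike.coe_injective (smul_assoc a b ⇑f)

end Fun

section Spaces

variable (𝕜 : Type*) [RCLike 𝕜]

/-! ### The Banach spaces `B n v` -/

/-- The space of all `f ∈ C^n(ℝ)` such that `f^(p) / v` is bounded for every `p ≤ n`. -/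
def B (n : ℕ) (v : Weight) : Submodule 𝕜 (Fun 𝕜) where
  carrier := {f : Fun 𝕜 | ContDiff ℝ n f ∧
    ∀ p ≤ n, BddAbove (Set.range fun x : ℝ => ‖iteratedDeriv p f x‖ / v x)}
  zero_mem' := by
    refine ⟨by rw [Fun.coe_zero]; exact contDiff_const, fun p _ => ⟨0, ?_⟩⟩
    rintro _ ⟨x, rfl⟩
    simp [Fun.coe_zero]
  add_mem' := by
    rintro f g ⟨hf, hf'⟩ ⟨hg, hg'⟩
    refine ⟨ContDiff.add hf hg, fun p hp => ?_⟩
    obtain ⟨a, ha⟩ := hf' p hp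
    obtain ⟨b, hb⟩ := hg' p hp
    refine ⟨a + b, ?_⟩
    rintro _ ⟨x, rfl⟩
    have hpn : ((p : ℕ) : WithTop ℕ∞) ≤ n := by exact_mod_cast hp
    have h : iteratedDeriv p (⇑f + ⇑g) x = iteratedDeriv p f x + iteratedDeriv p g x :=
      iteratedDeriv_add (hf.of_le hpn).contDiffAt (hg.of_le hpn).contDiffAt
    change ‖iteratedDeriv p (⇑f + ⇑g) x‖ / v x ≤ a + b
    rw [h]
    calc _ ≤ (‖iteratedDeriv p f x‖ + ‖iteratedDeriv p g x‖) / v x :=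
          div_le_div_of_nonneg_right (norm_add_le _ _) (v.pos x).le
      _ = ‖iteratedDeriv p f x‖ / v x + ‖iteratedDeriv p g x‖ / v x := add_div _ _ _
      _ ≤ a + b := add_le_add (ha ⟨x, rfl⟩) (hb ⟨x, rfl⟩)
  smul_mem' := by
    rintro c f ⟨hf, hf'⟩
    refine ⟨ContDiff.const_smul c hf, fun p hp => ?_⟩
    obtain ⟨a, ha⟩ := hf' p hp
    refine ⟨‖c‖ * a, ?_⟩
    rintro _ ⟨x, rfl⟩
    have hpn : ((p : ℕ) : WithTop ℕ∞) ≤ n := by exact_mod_cast hp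
    have h : iteratedDeriv p (c • ⇑f) x = c • iteratedDeriv p f x :=
      iteratedDeriv_const_smul (hf.of_le hpn).contDiffAt c
    change ‖iteratedDeriv p (c • ⇑f) x‖ / v x ≤ ‖c‖ * a
    rw [h, norm_smul, mul_div_assoc]
    exact mul_le_mul_of_nonneg_left (ha ⟨x, rfl⟩) (norm_nonneg c)

variable {𝕜} in
theorem mem_B {n : ℕ} {v : Weight} {f : Fun 𝕜} :
    f ∈ B 𝕜 n v ↔ ContDiff ℝ n f ∧
      ∀ p ≤ n, BddAbove (Set.range fun x : ℝ => ‖iteratedDeriv p f x‖ / v x) := Iff.rfl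

/-- The norm `max_{p ≤ n} sup_x |f^(p)(x)| / v(x)`. -/
def bNorm {n : ℕ} {v : Weight} (f : B 𝕜 n v) : ℝ :=
  ⨆ p : Fin (n + 1), ⨆ x : ℝ, ‖iteratedDeriv (p : ℕ) f.1 x‖ / v x

variable {𝕜} in
theorem le_bNorm {n : ℕ} {v : Weight} (f : B 𝕜 n v) {p : ℕ} (hp : p ≤ n) (x : ℝ) :
    ‖iteratedDeriv p f.1 x‖ / v x ≤ bNorm 𝕜 f :=
  (le_ciSup (f.2.2 p hp) x).trans
    (le_ciSup (f := fun p : Fin (n + 1) =>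
      ⨆ x : ℝ, ‖iteratedDeriv (p : ℕ) f.1 x‖ / v x)
      (Set.finite_range _).bddAbove ⟨p, Nat.lt_succ_of_le hp⟩)

variable {𝕜} in
theorem bNorm_le {n : ℕ} {v : Weight} (f : B 𝕜 n v) {C : ℝ}
    (h : ∀ p ≤ n, ∀ x : ℝ, ‖iteratedDeriv p f.1 x‖ / v x ≤ C) : bNorm 𝕜 f ≤ C :=
  ciSup_le fun p => ciSup_le fun x => h p (Nat.lt_succ_iff.1 p.2) x

variable {𝕜} in
theorem bNorm_nonneg {n : ℕ} {v : Weight} (f : B 𝕜 n v) : 0 ≤ bNorm 𝕜 f :=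
  (div_nonneg (norm_nonneg _) (v.pos 0).le).trans (le_bNorm f (Nat.zero_le n) 0)

variable {𝕜} in
theorem bNorm_add_le {n : ℕ} {v : Weight} (f g : B 𝕜 n v) :
    bNorm 𝕜 (f + g) ≤ bNorm 𝕜 f + bNorm 𝕜 g := by
  refine bNorm_le _ fun p hp x => ?_
  have hpn : ((p : ℕ) : WithTop ℕ∞) ≤ n := by exact_mod_cast hp
  have h : iteratedDeriv p (⇑f.1 + ⇑g.1) x
      = iteratedDeriv p f.1 x + iteratedDeriv p g.1 x :=
    iteratedDeriv_add (f.2.1.of_le hpn).contDiffAt (g.2.1.of_le hpn).contDiffAt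
  change ‖iteratedDeriv p (⇑f.1 + ⇑g.1) x‖ / v x ≤ _
  rw [h]
  calc _ ≤ (‖iteratedDeriv p f.1 x‖ + ‖iteratedDeriv p g.1 x‖) / v x :=
        div_le_div_of_nonneg_right (norm_add_le _ _) (v.pos x).le
    _ = _ := add_div _ _ _
    _ ≤ _ := add_le_add (le_bNorm f hp x) (le_bNorm g hp x)

variable {𝕜} in
theorem bNorm_smul_le {n : ℕ} {v : Weight} (c : 𝕜) (f : B 𝕜 n v) :
    bNorm 𝕜 (c • f) ≤ ‖c‖ * bNorm 𝕜 f := by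
  refine bNorm_le _ fun p hp x => ?_
  have hpn : ((p : ℕ) : WithTop ℕ∞) ≤ n := by exact_mod_cast hp
  have h : iteratedDeriv p (c • ⇑f.1) x = c • iteratedDeriv p f.1 x :=
    iteratedDeriv_const_smul (f.2.1.of_le hpn).contDiffAt c
  change ‖iteratedDeriv p (c • ⇑f.1) x‖ / v x ≤ _
  rw [h, norm_smul, mul_div_assoc]
  exact mul_le_mul_of_nonneg_left (le_bNorm f hp x) (norm_nonneg c)

variable {𝕜} in
theorem eq_zero_of_bNorm {n : ℕ} {v : Weight} (f : B 𝕜 n v) (h : bNorm 𝕜 f = 0) : f = 0 := by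
  apply Subtype.ext
  refine DFunLike.ext _ _ fun x => ?_
  have h1 := le_bNorm f (Nat.zero_le n) x
  rw [h, iteratedDeriv_zero, div_le_iff₀ (v.pos x), zero_mul] at h1
  exact norm_le_zero_iff.1 h1

/-- `bNorm` as a seminorm in the sense of Mathlib. -/
def bSeminorm (n : ℕ) (v : Weight) : Seminorm 𝕜 (B 𝕜 n v) :=
  Seminorm.ofSMulLE (bNorm 𝕜)
    (le_antisymm (by simpa using bNorm_smul_le (0 : 𝕜) (0 : B 𝕜 n v)) (bNorm_nonneg _))
    bNorm_add_le bNorm_smul_le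

instance (n : ℕ) (v : Weight) : NormedAddCommGroup (B 𝕜 n v) :=
  AddGroupNorm.toNormedAddCommGroup
    { (bSeminorm 𝕜 n v).toAddGroupSeminorm with
      eq_zero_of_map_eq_zero' := fun f hf => eq_zero_of_bNorm f hf }

variable {𝕜} in
theorem norm_def {n : ℕ} {v : Weight} (f : B 𝕜 n v) :
    ‖f‖ = ⨆ p : Fin (n + 1), ⨆ x : ℝ, ‖iteratedDeriv (p : ℕ) f.1 x‖ / v x := rfl

instance (n : ℕ) (v : Weight) : NormedSpace 𝕜 (B 𝕜 n v) where
  norm_smul_le c f := bNorm_smul_le c f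

/-! ### Projective and inductive limits of spaces of functions -/

section Limits

variable {𝕜} {ι : Type} (X : ι → Submodule 𝕜 (Fun 𝕜)) [∀ i, TopologicalSpace (X i)]

/-- The projective limit topology on the intersection of the spaces `X i`: the coarsest topology
for which all the inclusions into the `X i` are continuous. -/
@[reducible] def projTopology : TopologicalSpace (⨅ i, X i : Submodule 𝕜 (Fun 𝕜)) :=
  ⨅ i, TopologicalSpace.induced (Submodule.inclusion (iInf_le X i)) inferInstance

/-- The locally convex inductive limit topology on the span of the spaces `X i` (their union, if
they form a directed family): the finest locally convex vector space topology for which all the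
inclusions of the `X i` are continuous. -/
@[reducible] def indTopology : TopologicalSpace (⨆ i, X i : Submodule 𝕜 (Fun 𝕜)) :=
  sInf {t | (∀ i, @Continuous _ _ inferInstance t (Submodule.inclusion (le_iSup X i))) ∧
    @IsTopologicalAddGroup (⨆ i, X i : Submodule 𝕜 (Fun 𝕜)) t _ ∧
    @ContinuousSMul 𝕜 (⨆ i, X i : Submodule 𝕜 (Fun 𝕜)) _ _ t ∧
    @LocallyConvexSpace ℝ (⨆ i, X i : Submodule 𝕜 (Fun 𝕜)) _ _ _ _ t}

end Limits

/-! ### The weighted spaces of smooth functions -/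

/-- `K_v`, the projective limit over `N` of `B N (1 / v ^ N)`. -/
def K (v : Weight) : Submodule 𝕜 (Fun 𝕜) := ⨅ N : ℕ, B 𝕜 N (v ^ N)⁻¹

instance (v : Weight) : TopologicalSpace (K 𝕜 v) := projTopology fun N : ℕ => B 𝕜 N (v ^ N)⁻¹

/-- The projective limit over `n` of `B n v`. -/
def BInf (v : Weight) : Submodule 𝕜 (Fun 𝕜) := ⨅ n : ℕ, B 𝕜 n v

instance (v : Weight) : TopologicalSpace (BInf 𝕜 v) := projTopology fun n : ℕ => B 𝕜 n v

/-- `O_{C,v}`, the inductive limit over `N` of the projective limits over `n` of `B n (v ^ N)`. -/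
def OC (v : Weight) : Submodule 𝕜 (Fun 𝕜) := ⨆ N : ℕ, BInf 𝕜 (v ^ N)

instance (v : Weight) : TopologicalSpace (OC 𝕜 v) := indTopology fun N : ℕ => BInf 𝕜 (v ^ N)

/-- The inductive limit over `N` of `B n (v ^ N)`. -/
def OMn (n : ℕ) (v : Weight) : Submodule 𝕜 (Fun 𝕜) := ⨆ N : ℕ, B 𝕜 n (v ^ N)

instance (n : ℕ) (v : Weight) : TopologicalSpace (OMn 𝕜 n v) :=
  indTopology fun N : ℕ => B 𝕜 n (v ^ N)

/-- `O_{M,v}`, the projective limit over `n` of the inductive limits over `N` of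
`B n (v ^ N)`. -/
def OM (v : Weight) : Submodule 𝕜 (Fun 𝕜) := ⨅ n : ℕ, OMn 𝕜 n v

instance (v : Weight) : TopologicalSpace (OM 𝕜 v) := projTopology fun n : ℕ => OMn 𝕜 n v

/-! For weights `v ≥ 1` the inductive limits are unions, as they should be. -/

variable {𝕜}

theorem B_mono (n : ℕ) {v : Weight} (hv : ∀ x, 1 ≤ v x) :
    Monotone fun N : ℕ => B 𝕜 n (v ^ N) := by
  rintro N M hNM f ⟨hf, hf'⟩
  refine ⟨hf, fun p hp => ?_⟩
  obtain ⟨a, ha⟩ := hf' p hp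
  refine ⟨a, ?_⟩
  rintro _ ⟨x, rfl⟩
  exact (div_le_div_of_nonneg_left (norm_nonneg _) ((v ^ N).pos x)
    (pow_le_pow_right₀ (hv x) hNM)).trans (ha ⟨x, rfl⟩)

theorem mem_K {v : Weight} {f : Fun 𝕜} : f ∈ K 𝕜 v ↔ ∀ N : ℕ, f ∈ B 𝕜 N (v ^ N)⁻¹ :=
  Submodule.mem_iInf _

theorem mem_OC {v : Weight} (hv : ∀ x, 1 ≤ v x) {f : Fun 𝕜} :
    f ∈ OC 𝕜 v ↔ ∃ N : ℕ, ∀ n : ℕ, f ∈ B 𝕜 n (v ^ N) := by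
  have hm : Monotone fun N : ℕ => BInf 𝕜 (v ^ N) :=
    fun N M h => iInf_mono fun n => B_mono n hv h
  rw [OC, Submodule.mem_iSup_of_directed _ hm.directed_le]
  exact exists_congr fun N => Submodule.mem_iInf _

theorem mem_OM {v : Weight} (hv : ∀ x, 1 ≤ v x) {f : Fun 𝕜} :
    f ∈ OM 𝕜 v ↔ ∀ n : ℕ, ∃ N : ℕ, f ∈ B 𝕜 n (v ^ N) := by
  rw [OM, Submodule.mem_iInf]
  exact forall_congr' fun n => Submodule.mem_iSup_of_directed _ (B_mono n hv).directed_le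

/-! ### Composition operators -/

variable (𝕜) in
/-- The composition operator `f ↦ f ∘ φ`, on all functions. -/
def compOp (φ : ℝ → ℝ) : Fun 𝕜 →ₗ[𝕜] Fun 𝕜 where
  toFun f := ⟨fun x => f (φ x)⟩
  map_add' _ _ := rfl
  map_smul' _ _ := rfl

theorem compOp_apply (φ : ℝ → ℝ) (f : Fun 𝕜) (x : ℝ) : compOp 𝕜 φ f x = f (φ x) := rfl

/-- `C_φ : X → Y` is well defined and continuous. -/
def CompContinuous (φ : ℝ → ℝ) (X Y : Submodule 𝕜 (Fun 𝕜))
    [TopologicalSpace X] [TopologicalSpace Y] : Prop :=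
  ∃ h : ∀ f ∈ X, compOp 𝕜 φ f ∈ Y, Continuous ((compOp 𝕜 φ).restrict h)

end Spaces

end WeightedSmooth

end

noncomputable section

namespace WeightedSmooth

/-! ### Growth of real functions -/

/-! Since the weights are at least one, real exponents may be replaced by natural ones. Sufficiency
of the growth conditions is a norm estimate: a Faà di Bruno bound (`compContinuous_B`) makes `C_φ`
bounded between suitable spaces `B`, and the universal properties of projective and inductive limits
carry continuity over to the limit spaces.

Necessity is tested on a few functions. To control the derivatives of `φ`, use `φ' = cos φ · (sin
φ)' - sin φ · (cos φ)'`. If `sin ∘ φ` and `cos ∘ φ` have all their derivatives in an algebra, then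
every derivative of `φ` of positive order lies there. As `1`, `sin` and `cos` belong to `O_{C,v}`
and `O_{M,v}`, this settles (III) with the algebra of polynomial growth. In (II) the derivatives of
`sin ∘ φ` are all bounded by multiples of one power of `w`; interpolating between the bounded
function and derivatives of ever higher order (`exists_abs_iteratedDeriv_le`) makes the exponent
arbitrarily small. The bound on `v ∘ φ` comes from a smooth function comparable with `v`, obtained
by mollifying (`exists_smoothIn_ge`).

In (I) sine and cosine do not decay, so they are multiplied by some `f` in `K_v`. With `F = f ∘ φ`,
the same identity bounds `F ^ (p + 2) * φ^(p+1)` (`SmoothIn.pow_mul_iteratedDeriv`). A sum of bumps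
placed along a sequence where the desired estimate fails then shows that boundedness for all such
`f` forces polynomial growth (`exists_le_of_rapidDecay`). -/

/-- The functions bounded by a multiple of `u`. -/
def dominated (u : ℝ → ℝ) : Submodule ℝ (ℝ → ℝ) where
  carrier := {h | ∃ C : ℝ, ∀ x, |h x| ≤ C * u x}
  zero_mem' := ⟨0, fun x => by simp⟩
  add_mem' := by
    rintro f g ⟨a, ha⟩ ⟨b, hb⟩
    refine ⟨a + b, fun x => (abs_add_le _ _).trans ?_⟩
    rw [add_mul]
    exact add_le_add (ha x) (hb x)
  smul_mem' := by
    rintro c f ⟨a, ha⟩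
    refine ⟨|c| * a, fun x => ?_⟩
    rw [Pi.smul_apply, smul_eq_mul, abs_mul, mul_assoc]
    exact mul_le_mul_of_nonneg_left (ha x) (abs_nonneg c)

theorem mem_dominated {u h : ℝ → ℝ} : h ∈ dominated u ↔ ∃ C : ℝ, ∀ x, |h x| ≤ C * u x := Iff.rfl

theorem dominated_mono {u u' : ℝ → ℝ} (hu' : ∀ x, 0 < u x) (h : ∀ x, u x ≤ u' x) :
    dominated u ≤ dominated u' := by
  rintro f ⟨C, hC⟩
  have hC0 : 0 ≤ C := nonneg_of_mul_nonneg_left ((abs_nonneg _).trans (hC 0)) (hu' 0)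
  exact ⟨C, fun x => (hC x).trans (mul_le_mul_of_nonneg_left (h x) hC0)⟩

theorem mul_mem_dominated {u u' f g : ℝ → ℝ} (hf : f ∈ dominated u) (hg : g ∈ dominated u') :
    (fun x => f x * g x) ∈ dominated fun x => u x * u' x := by
  obtain ⟨a, ha⟩ := hf
  obtain ⟨b, hb⟩ := hg
  refine ⟨a * b, fun x => ?_⟩
  rw [abs_mul, mul_mul_mul_comm]
  exact mul_le_mul (ha x) (hb x) (abs_nonneg _) ((abs_nonneg _).trans (ha x))

/-- The functions of at most polynomial growth with respect to `w`. -/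
def polynomialGrowth (w : ℝ → ℝ) : Submodule ℝ (ℝ → ℝ) := ⨆ N : ℕ, dominated fun x => w x ^ N

theorem mem_polynomialGrowth {w h : ℝ → ℝ} (hw : ∀ x, 1 ≤ w x) :
    h ∈ polynomialGrowth w ↔ ∃ N : ℕ, ∃ C : ℝ, ∀ x, |h x| ≤ C * w x ^ N := by
  have hm : Monotone fun N : ℕ => dominated fun x => w x ^ N := fun N M hNM =>
    dominated_mono (fun x => pow_pos (one_pos.trans_le (hw x)) N)
      fun x => pow_le_pow_right₀ (hw x) hNM
  exact Submodule.mem_iSup_of_directed _ hm.directed_le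

theorem mul_mem_polynomialGrowth {w : ℝ → ℝ} (hw : ∀ x, 1 ≤ w x) {f g : ℝ → ℝ}
    (hf : f ∈ polynomialGrowth w) (hg : g ∈ polynomialGrowth w) :
    (fun x => f x * g x) ∈ polynomialGrowth w := by
  rw [mem_polynomialGrowth hw] at *
  obtain ⟨N, hN⟩ := hf
  obtain ⟨M, hM⟩ := hg
  refine ⟨N + M, ?_⟩
  simpa only [pow_add] using mem_dominated.1 (mul_mem_dominated hN hM)

/-- The functions that grow more slowly than every positive power of `w`. -/
def subpolynomialGrowth (w : ℝ → ℝ) : Submodule ℝ (ℝ → ℝ) :=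
  ⨅ k : ℕ, dominated fun x => w x ^ (1 / ((k : ℝ) + 1))

theorem mem_subpolynomialGrowth {w h : ℝ → ℝ} :
    h ∈ subpolynomialGrowth w ↔ ∀ k : ℕ, ∃ C : ℝ, ∀ x, |h x| ≤ C * w x ^ (1 / ((k : ℝ) + 1)) :=
  Submodule.mem_iInf _

theorem mul_mem_subpolynomialGrowth {w : ℝ → ℝ} (hw : ∀ x, 1 ≤ w x) {f g : ℝ → ℝ}
    (hf : f ∈ subpolynomialGrowth w) (hg : g ∈ subpolynomialGrowth w) :
    (fun x => f x * g x) ∈ subpolynomialGrowth w := by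
  rw [mem_subpolynomialGrowth] at *
  intro k
  -- Each factor gets the exponent `1 / (2k + 2)`, half of the target `1 / (k + 1)`.
  obtain ⟨C, hC⟩ := mul_mem_dominated (hf (2 * k + 1)) (hg (2 * k + 1))
  refine ⟨C, fun x => (hC x).trans_eq ?_⟩
  beta_reduce
  rw [← Real.rpow_add (one_pos.trans_le (hw x))]
  congr 2
  push_cast
  field_simp
  ring

/-- The functions that decay faster than every power of `1 / v`. -/
def rapidDecay (v : ℝ → ℝ) : Submodule ℝ (ℝ → ℝ) := ⨅ N : ℕ, dominated fun x => (v x ^ N)⁻¹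

theorem mem_rapidDecay {v h : ℝ → ℝ} :
    h ∈ rapidDecay v ↔ ∀ N : ℕ, ∃ C : ℝ, ∀ x, |h x| ≤ C * (v x ^ N)⁻¹ :=
  Submodule.mem_iInf _

theorem mul_mem_rapidDecay {v f g : ℝ → ℝ} (hf : f ∈ rapidDecay v)
    (hg : g ∈ dominated fun _ => 1) : (fun x => f x * g x) ∈ rapidDecay v := by
  rw [mem_rapidDecay] at *
  intro N
  simpa only [mul_one] using mem_dominated.1 (mul_mem_dominated (hf N) hg)

/-- For a function `w ≥ 1`, real and natural exponents give the same notion of polynomial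
growth. -/
theorem exists_div_rpow_le_iff {h u : ℝ → ℝ} (hu : ∀ x, 1 ≤ u x) :
    (∃ r : ℝ, 0 < r ∧ ∃ C : ℝ, ∀ x, |h x| / u x ^ r ≤ C) ↔
      ∃ N : ℕ, ∃ C : ℝ, ∀ x, |h x| ≤ C * u x ^ N := by
  have hu0 x : 0 < u x := one_pos.trans_le (hu x)
  constructor
  · rintro ⟨r, hr, C, hC⟩
    have hC0 : 0 ≤ C := (div_nonneg (abs_nonneg _) (Real.rpow_nonneg (hu0 0).le r)).trans (hC 0)
    refine ⟨⌈r⌉₊, C, fun x => ((div_le_iff₀ (Real.rpow_pos_of_pos (hu0 x) r)).1 (hC x)).trans ?_⟩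
    refine mul_le_mul_of_nonneg_left ?_ hC0
    rw [← Real.rpow_natCast]
    exact Real.rpow_le_rpow_of_exponent_le (hu x) (Nat.le_ceil r)
  · rintro ⟨N, C, hC⟩
    have hC0 : 0 ≤ C :=
      nonneg_of_mul_nonneg_left ((abs_nonneg _).trans (hC 0)) (pow_pos (hu0 0) N)
    -- The real exponent has to be positive even when `N = 0`.
    refine ⟨N + 1, by positivity, C, fun x => ?_⟩
    rw [div_le_iff₀ (Real.rpow_pos_of_pos (hu0 x) _)]
    refine (hC x).trans (mul_le_mul_of_nonneg_left ?_ hC0)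
    rw [← Real.rpow_natCast]
    exact Real.rpow_le_rpow_of_exponent_le (hu x) (by linarith)

/-- The translation condition on a weight, with natural exponents. -/
theorem exists_translate_le {v : ℝ → ℝ} (hv : ∀ x, 1 ≤ v x)
    (h : ∃ r : ℝ, 0 < r ∧ ∃ C : ℝ, ∀ x t : ℝ, |t| ≤ 1 → v (x + t) / v x ^ r ≤ C) :
    ∃ L : ℕ, ∃ C : ℝ, 1 ≤ C ∧ ∀ x t : ℝ, |t| ≤ 1 → v (x + t) ≤ C * v x ^ L := by
  obtain ⟨r, hr, C, hC⟩ := h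
  have hv0 x : 0 < v x := one_pos.trans_le (hv x)
  refine ⟨⌈r⌉₊, max C 1, le_max_right _ _, fun x t ht =>
    ((div_le_iff₀ (Real.rpow_pos_of_pos (hv0 x) r)).1 (hC x t ht)).trans ?_⟩
  refine mul_le_mul (le_max_left _ _) ?_ (Real.rpow_nonneg (hv0 x).le r)
    (zero_le_one.trans (le_max_right _ _))
  rw [← Real.rpow_natCast]
  exact Real.rpow_le_rpow_of_exponent_le (hv x) (Nat.le_ceil r)

/-! ### Smooth functions whose derivatives belong to a given space -/

/-- `f` is smooth and all its derivatives belong to `P`. -/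
def SmoothIn (P : Submodule ℝ (ℝ → ℝ)) (f : ℝ → ℝ) : Prop :=
  ContDiff ℝ ∞ f ∧ ∀ p : ℕ, iteratedDeriv p f ∈ P

namespace SmoothIn

variable {P Q R : Submodule ℝ (ℝ → ℝ)} {f g : ℝ → ℝ}

theorem deriv (hf : SmoothIn P f) : SmoothIn P (deriv f) :=
  ⟨(contDiff_infty_iff_deriv.1 hf.1).2, fun p => iteratedDeriv_succ' (f := f) ▸ hf.2 (p + 1)⟩

theorem const_mul (c : ℝ) (hf : SmoothIn P f) : SmoothIn P fun x => c * f x := by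
  refine ⟨contDiff_const.mul hf.1, fun p => ?_⟩
  have : iteratedDeriv p (fun x => c * f x) = c • iteratedDeriv p f :=
    funext fun x => iteratedDeriv_const_mul_field c f
  exact this ▸ P.smul_mem c (hf.2 p)

theorem sub (hf : SmoothIn P f) (hg : SmoothIn P g) : SmoothIn P fun x => f x - g x := by
  refine ⟨hf.1.sub hg.1, fun p => ?_⟩
  have hp : (p : WithTop ℕ∞) ≤ ∞ := by exact_mod_cast le_top
  have : iteratedDeriv p (fun x => f x - g x) = iteratedDeriv p f - iteratedDeriv p g :=
    funext fun x => iteratedDeriv_sub (hf.1.of_le hp).contDiffAt (hg.1.of_le hp).contDiffAt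
  exact this ▸ P.sub_mem (hf.2 p) (hg.2 p)

/-- This is Leibniz' rule. With three spaces it covers both algebras and the product of a rapidly
decaying function with a bounded one. -/
theorem mul (h : ∀ f ∈ P, ∀ g ∈ Q, (fun x => f x * g x) ∈ R)
    (hf : SmoothIn P f) (hg : SmoothIn Q g) : SmoothIn R fun x => f x * g x := by
  refine ⟨hf.1.mul hg.1, fun p => ?_⟩
  have hp : (p : WithTop ℕ∞) ≤ ∞ := by exact_mod_cast le_top
  have : iteratedDeriv p (fun x => f x * g x) = ∑ i ∈ Finset.range (p + 1),
      (p.choose i : ℝ) • fun x => iteratedDeriv i f x * iteratedDeriv (p - i) g x := by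
    funext x
    rw [iteratedDeriv_fun_mul (hf.1.of_le hp).contDiffAt (hg.1.of_le hp).contDiffAt,
      Finset.sum_apply]
    exact Finset.sum_congr rfl fun i _ => by simp [mul_assoc]
  rw [this]
  exact R.sum_mem fun i _ => R.smul_mem _ (h _ (hf.2 i) _ (hg.2 _))

/-- If `F`, `F * sin φ` and `F * cos φ` belong to an algebra that is closed under
differentiation, then so do suitable products of a power of `F` and the derivatives of `φ`. -/
theorem pow_mul_iteratedDeriv (h : ∀ f ∈ P, ∀ g ∈ P, (fun x => f x * g x) ∈ P) {F φ : ℝ → ℝ}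
    (hφ : ContDiff ℝ ∞ φ) (hF : SmoothIn P F) (hs : SmoothIn P fun x => F x * Real.sin (φ x))
    (hc : SmoothIn P fun x => F x * Real.cos (φ x)) (p : ℕ) :
    SmoothIn P fun x => F x ^ (p + 2) * iteratedDeriv (p + 1) φ x := by
  have hFd x : HasDerivAt F (_root_.deriv F x) x :=
    (hF.1.differentiable (by simp) x).hasDerivAt
  have hφd x : HasDerivAt φ (_root_.deriv φ x) x :=
    (hφ.differentiable (by simp) x).hasDerivAt
  induction p with
  | zero =>
    have hsd x := ((hFd x).mul (hφd x).sin).deriv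
    have hcd x := ((hFd x).mul (hφd x).cos).deriv
    -- The terms with `F'` cancel in `(F sin φ)' F cos φ - (F cos φ)' F sin φ`, which leaves `F²
    -- φ'`.
    convert (hs.deriv.mul h hc).sub (hc.deriv.mul h hs) using 2 with x
    have e1 := hsd x
    have e2 := hcd x
    simp only [Pi.mul_def] at e1 e2
    rw [e1, e2, zero_add, zero_add, iteratedDeriv_one]
    linear_combination (-(F x) ^ 2 * _root_.deriv φ x) * Real.sin_sq_add_cos_sq (φ x)
  | succ p ih =>
    -- One more factor `F` makes the unwanted term of the product rule, `(p + 2) F ^ (p + 2) F'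
    -- φ^(p+1)`, a multiple of `F'` times the previous product.
    convert (hF.mul h ih.deriv).sub ((hF.deriv.mul h ih).const_mul ((p : ℝ) + 2)) using 2 with x
    have hd : HasDerivAt (iteratedDeriv (p + 1) φ) (iteratedDeriv (p + 2) φ x) x := by
      rw [iteratedDeriv_succ (n := p + 1)]
      exact (hφ.differentiable_iteratedDeriv (p + 1)
        (by exact_mod_cast WithTop.coe_lt_top _) x).hasDerivAt
    have e := (((hFd x).pow (p + 2)).mul hd).deriv
    simp only [Pi.mul_def, Pi.pow_def] at e
    rw [e]
    push_cast
    ring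

end SmoothIn

theorem smoothIn_sin : SmoothIn (dominated fun _ => 1) Real.sin :=
  ⟨Real.contDiff_sin, fun p => ⟨1, fun x => by
    simpa using Real.abs_iteratedDeriv_sin_le_one p x⟩⟩

theorem smoothIn_cos : SmoothIn (dominated fun _ => 1) Real.cos :=
  ⟨Real.contDiff_cos, fun p => ⟨1, fun x => by
    simpa using Real.abs_iteratedDeriv_cos_le_one p x⟩⟩

theorem smoothIn_const (c : ℝ) : SmoothIn (dominated fun _ => 1) fun _ => c :=
  ⟨contDiff_const, fun p => ⟨|c|, fun x => by
    rw [iteratedDeriv_const]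
    split_ifs <;> simp⟩⟩

/-! ### A Landau-Kolmogorov inequality -/

/-- The coefficients of a polynomial are controlled by its values at finitely many points. -/
theorem exists_abs_coeff_le (n : ℕ) : ∃ K : ℝ, 0 ≤ K ∧ ∀ (c : Fin (n + 1) → ℝ) (A : ℝ),
    (∀ s ∈ Set.Icc (0 : ℝ) 1, |∑ k : Fin (n + 1), s ^ (k : ℕ) * c k| ≤ A) →
      ∀ k, |c k| ≤ K * A := by
  -- Distinct nodes in the unit interval: their Vandermonde matrix is invertible and recovers the
  -- coefficients from the values.
  let s : Fin (n + 1) → ℝ := fun j => (j : ℝ) / (n + 1)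
  have hs j : s j ∈ Set.Icc (0 : ℝ) 1 := by
    refine ⟨by positivity, (div_le_one (by positivity)).2 ?_⟩
    exact_mod_cast j.2.le
  have hinj : Function.Injective s := fun i j hij => by
    have : (i : ℝ) = j := (div_left_inj' (by positivity)).1 hij
    exact Fin.ext (by exact_mod_cast this)
  let V := Matrix.vandermonde s
  have hV : IsUnit V.det := (Matrix.det_vandermonde_ne_zero_iff.2 hinj).isUnit
  refine ⟨∑ k, ∑ j, |V⁻¹ k j|, by positivity, fun c A hA k => ?_⟩
  have hA0 : 0 ≤ A := (abs_nonneg _).trans (hA _ (hs 0))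
  have hc : c = V⁻¹.mulVec (V.mulVec c) := by
    rw [Matrix.mulVec_mulVec, Matrix.nonsing_inv_mul _ hV, Matrix.one_mulVec]
  calc |c k| = |∑ j, V⁻¹ k j * ∑ i : Fin (n + 1), s j ^ (i : ℕ) * c i| := by
        conv_lhs => rw [hc]
        rfl
    _ ≤ ∑ j, |V⁻¹ k j| * A := (Finset.abs_sum_le_sum_abs _ _).trans
        (Finset.sum_le_sum fun j _ => by
          rw [abs_mul]
          exact mul_le_mul_of_nonneg_left (hA _ (hs j)) (abs_nonneg _))
    _ = (∑ j, |V⁻¹ k j|) * A := by rw [Finset.sum_mul]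
    _ ≤ _ := mul_le_mul_of_nonneg_right
        (Finset.single_le_sum (f := fun k => ∑ j, |V⁻¹ k j|)
          (fun _ _ => by positivity) (Finset.mem_univ k)) hA0

/-- The derivatives of order `k ≤ n` are controlled by the function and its derivative of order
`n + 1`. -/
theorem exists_abs_iteratedDeriv_le (n : ℕ) : ∃ K : ℝ, 0 ≤ K ∧ ∀ (f : ℝ → ℝ) (x A W : ℝ),
    ContDiff ℝ ∞ f → 1 ≤ W → (∀ y ∈ Set.Icc x (x + 1), |f y| ≤ A) →
      (∀ y ∈ Set.Icc x (x + 1), |iteratedDeriv (n + 1) f y| ≤ A * W ^ (n + 1)) →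
        ∀ k ≤ n, |iteratedDeriv k f x| ≤ K * A * W ^ k := by
  obtain ⟨K, hK0, hK⟩ := exists_abs_coeff_le n
  refine ⟨n.factorial * (K * 2), by positivity, fun f x A W hf hW hf0 hfn k hk => ?_⟩
  have hW0 : 0 < W := one_pos.trans_le hW
  have hx : x < x + 1 := by linarith
  have hA0 : 0 ≤ A := (abs_nonneg _).trans (hf0 x ⟨le_rfl, hx.le⟩)
  have hd : ∀ p : ℕ, ∀ y ∈ Set.Icc x (x + 1),
      iteratedDerivWithin p f (Set.Icc x (x + 1)) y = iteratedDeriv p f y := fun p y hy =>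
    iteratedDerivWithin_eq_iteratedDeriv (uniqueDiffOn_Icc hx)
      (hf.of_le (by exact_mod_cast le_top)).contDiffAt hy
  -- These are the coefficients of the Taylor polynomial at `x` in the rescaled variable `s`, the
  -- step being `s / W`. As `W ≥ 1`, the step stays in the unit interval, and the remainder is at
  -- most `A`.
  let c : Fin (n + 1) → ℝ := fun i => ((i : ℕ).factorial : ℝ)⁻¹ * iteratedDeriv i f x / W ^ (i : ℕ)
  have hc : ∀ s ∈ Set.Icc (0 : ℝ) 1, |∑ i : Fin (n + 1), s ^ (i : ℕ) * c i| ≤ 2 * A := by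
    rintro s ⟨hs0, hs1⟩
    have hsW0 : 0 ≤ s / W := by positivity
    have hsW1 : s / W ≤ 1 := (div_le_one hW0).2 (hs1.trans hW)
    have hmem : x + s / W ∈ Set.Icc x (x + 1) := ⟨by linarith, by linarith⟩
    have hT := taylor_mean_remainder_bound (n := n) hx.le
      (hf.of_le (by exact_mod_cast le_top)).contDiffOn hmem
      (fun y hy => by rw [hd _ y hy]; exact hfn y hy)
    have hpoly : taylorWithinEval f n (Set.Icc x (x + 1)) x (x + s / W) =
        ∑ i : Fin (n + 1), s ^ (i : ℕ) * c i := by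
      rw [taylor_within_apply, Finset.sum_range]
      refine Finset.sum_congr rfl fun i _ => ?_
      rw [hd _ x ⟨le_rfl, hx.le⟩, smul_eq_mul, add_sub_cancel_left, div_pow]
      ring
    have hrem : A * W ^ (n + 1) * (x + s / W - x) ^ (n + 1) / n.factorial ≤ A := by
      rw [add_sub_cancel_left, div_pow, mul_assoc, mul_div_cancel₀ _ (by positivity), mul_div_assoc]
      refine mul_le_of_le_one_right hA0 ((div_le_one (by positivity)).2 ?_)
      exact (pow_le_one₀ hs0 hs1).trans (by exact_mod_cast n.factorial_pos)
    rw [hpoly] at hT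
    have h1 := hT.trans hrem
    have h2 := hf0 _ hmem
    rw [Real.norm_eq_abs, abs_le] at h1
    rw [abs_le] at h2 ⊢
    constructor <;> linarith [h1.1, h1.2, h2.1, h2.2]
  have hk' := hK c (2 * A) hc ⟨k, Nat.lt_succ_of_le hk⟩
  have hkf : (0 : ℝ) < k.factorial := by exact_mod_cast k.factorial_pos
  have hkn : (k.factorial : ℝ) ≤ n.factorial := by exact_mod_cast Nat.factorial_le hk
  have hWk : 0 < W ^ k := by positivity
  simp only [c] at hk'
  rw [abs_div, abs_mul, abs_of_pos (inv_pos.2 hkf), abs_of_pos hWk, div_le_iff₀ hWk,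
    inv_mul_le_iff₀ hkf] at hk'
  calc _ ≤ k.factorial * (K * (2 * A) * W ^ k) := hk'
    _ ≤ n.factorial * (K * (2 * A) * W ^ k) := mul_le_mul_of_nonneg_right hkn (by positivity)
    _ = _ := by ring

/-- If a bounded function has derivatives that are all bounded by multiples of the same power
of `w`, then the derivatives grow more slowly than every positive power of `w`. -/
theorem smoothIn_subpolynomialGrowth {w : ℝ → ℝ} (hw : ∀ x, 1 ≤ w x) {L : ℕ} {C : ℝ}
    (hL : ∀ x t : ℝ, |t| ≤ 1 → w (x + t) ≤ C * w x ^ L) {f : ℝ → ℝ}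
    (hf : f ∈ dominated fun _ => 1) {N : ℕ} (hfN : SmoothIn (dominated fun x => w x ^ N) f) :
    SmoothIn (subpolynomialGrowth w) f := by
  refine ⟨hfN.1, fun p => mem_subpolynomialGrowth.2 fun k => ?_⟩
  have hw0 x : 0 < w x := one_pos.trans_le (hw x)
  -- Interpolation will give the exponent `N L p / (n + 1)`; the first summand makes it at most `1 /
  -- (k + 1)`, the second ensures `p ≤ n`.
  let n : ℕ := N * L * p * (k + 1) + p
  obtain ⟨K, hK0, hK⟩ := exists_abs_iteratedDeriv_le n
  obtain ⟨a, ha⟩ := hf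
  obtain ⟨b, hb⟩ := hfN.2 (n + 1)
  let A := max a (b * C ^ N)
  have hA0 : 0 ≤ A := by
    have := (abs_nonneg _).trans (ha 0)
    rw [mul_one] at this
    exact this.trans (le_max_left _ _)
  have hb0 : 0 ≤ b := nonneg_of_mul_nonneg_left ((abs_nonneg _).trans (hb 0)) (pow_pos (hw0 0) N)
  refine ⟨K * A, fun x => ?_⟩
  -- Chosen so that `W ^ (n + 1) = w x ^ (L N)`, which is, up to the factor `C ^ N`, a bound for `w
  -- ^ N` on `[x, x + 1]`.
  let W := w x ^ (((N * L : ℕ) : ℝ) / ((n : ℝ) + 1))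
  have hWn : W ^ (n + 1) = (w x ^ L) ^ N := by
    rw [← Real.rpow_natCast, ← Real.rpow_mul (hw0 x).le, ← pow_mul, mul_comm L N,
      ← Real.rpow_natCast]
    congr 1
    push_cast
    field_simp
  have key := hK f x A W hfN.1 (Real.one_le_rpow (hw x) (by positivity))
    (fun y _ => (ha y).trans (by rw [mul_one]; exact le_max_left _ _))
    (fun y hy => by
      refine (hb y).trans ?_
      have hy' : w y ≤ C * w x ^ L := by
        have := hL x (y - x) (by rw [abs_le]; constructor <;> linarith [hy.1, hy.2])
        rwa [add_sub_cancel] at this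
      calc b * w y ^ N ≤ b * (C * w x ^ L) ^ N :=
            mul_le_mul_of_nonneg_left (pow_le_pow_left₀ (hw0 y).le hy' N) hb0
        _ = b * C ^ N * (w x ^ L) ^ N := by ring
        _ ≤ A * W ^ (n + 1) := by
            rw [hWn]
            exact mul_le_mul_of_nonneg_right (le_max_right _ _)
              (pow_nonneg (pow_nonneg (hw0 x).le L) N))
    p (Nat.le_add_left _ _)
  refine key.trans (mul_le_mul_of_nonneg_left ?_ (mul_nonneg hK0 hA0))
  rw [← Real.rpow_natCast, ← Real.rpow_mul (hw0 x).le]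
  refine Real.rpow_le_rpow_of_exponent_le (hw x) ?_
  rw [div_mul_eq_mul_div, div_le_div_iff₀ (by positivity) (by positivity)]
  simp only [n]
  push_cast
  have : (0 : ℝ) ≤ p := by positivity
  linarith

/-! ### Smooth functions comparable with a weight -/

-- All derivatives fall on `ψ`, so `u` need not be differentiable, and the growth of the result does
-- not depend on `p`.
open MeasureTheory Convolution in
theorem iteratedDeriv_convolution {u ψ : ℝ → ℝ} (hu : Continuous u) (hψ : ContDiff ℝ ∞ ψ)
    (hc : HasCompactSupport ψ) (p : ℕ) :
    iteratedDeriv p (u ⋆[ContinuousLinearMap.mul ℝ ℝ] ψ) =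
      u ⋆[ContinuousLinearMap.mul ℝ ℝ] iteratedDeriv p ψ := by
  induction p generalizing ψ with
  | zero => simp
  | succ p ih =>
    have hd : deriv (u ⋆[ContinuousLinearMap.mul ℝ ℝ] ψ) =
        u ⋆[ContinuousLinearMap.mul ℝ ℝ] deriv ψ := funext fun x =>
      (hc.hasDerivAt_convolution_right (ContinuousLinearMap.mul ℝ ℝ) hu.locallyIntegrable
        (hψ.of_le (by exact_mod_cast le_top)) x).deriv
    rw [iteratedDeriv_succ', iteratedDeriv_succ', hd,
      ih (contDiff_infty_iff_deriv.1 hψ).2 hc.deriv]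

/-- A smooth nonnegative function that is supported in the unit ball and has integral one. -/
theorem exists_mollifier : ∃ ψ : ℝ → ℝ, ContDiff ℝ ∞ ψ ∧ HasCompactSupport ψ ∧ (∀ x, 0 ≤ ψ x) ∧
    (∀ x, ψ x ≠ 0 → |x| < 1) ∧ ∫ x, ψ x = 1 := by
  let b : ContDiffBump (0 : ℝ) := ⟨1 / 2, 1, by norm_num, by norm_num⟩
  refine ⟨b.normed MeasureTheory.volume, b.contDiff_normed, b.hasCompactSupport_normed,
    b.nonneg_normed, fun x hx => ?_, b.integral_normed⟩
  have : x ∈ Function.support (b.normed MeasureTheory.volume) := hx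
  rw [b.support_normed_eq] at this
  simpa using this

theorem iteratedDeriv_eq_zero_of_one_lt {ψ : ℝ → ℝ} (hψ : ∀ x, ψ x ≠ 0 → |x| < 1) (p : ℕ) {x : ℝ}
    (hx : 1 < |x|) : iteratedDeriv p ψ x = 0 := by
  have h0 : ψ =ᶠ[nhds x] fun _ => 0 := by
    filter_upwards [(isOpen_lt continuous_const continuous_abs).mem_nhds hx] with y hy
    by_contra hne
    exact lt_asymm hy (hψ y hne)
  rw [h0.iteratedDeriv_eq p, iteratedDeriv_fun_const_zero]

open MeasureTheory Convolution in
/-- There is a smooth function that is larger than `v` and whose derivatives are all bounded by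
multiples of the same power of `v`. -/
theorem exists_smoothIn_ge {v : ℝ → ℝ} (hvc : Continuous v) (hv : ∀ x, 1 ≤ v x) {L : ℕ} {C : ℝ}
    (hC : 1 ≤ C) (hL : ∀ x t : ℝ, |t| ≤ 1 → v (x + t) ≤ C * v x ^ L) :
    ∃ f : ℝ → ℝ, ∃ N : ℕ, SmoothIn (dominated fun x => v x ^ N) f ∧ ∀ x, v x ≤ C * f x := by
  obtain ⟨ψ, hψ, hψc, hψ0, hψs, hψ1⟩ := exists_mollifier
  have hv0 x : 0 < v x := one_pos.trans_le (hv x)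
  have hC0 : 0 < C := one_pos.trans_le hC
  have huc : Continuous fun x => v x ^ L := hvc.pow L
  -- The power `v ^ L` is mollified because `v x ≤ C * v (x - t) ^ L` for `|t| ≤ 1`, so its local
  -- averages dominate `v / C`. Conversely `v (x - t) ^ L ≤ C ^ L * v x ^ (L * L)`, whence the
  -- exponent `L * L`.
  refine ⟨(fun x => v x ^ L) ⋆[ContinuousLinearMap.mul ℝ ℝ] ψ, L * L, ⟨?_, fun p => ?_⟩, fun x => ?_⟩
  · exact hψc.contDiff_convolution_right _ huc.locallyIntegrable hψ
  · rw [iteratedDeriv_convolution huc hψ hψc]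
    have hpc : Continuous (iteratedDeriv p ψ) :=
      hψ.continuous_iteratedDeriv p (by exact_mod_cast le_top)
    have hsupp : HasCompactSupport (iteratedDeriv p ψ) := by
      refine HasCompactSupport.of_support_subset_isCompact (isCompact_Icc (a := -1) (b := 1))
        fun x hx => ?_
      by_contra hne
      refine hx (iteratedDeriv_eq_zero_of_one_lt hψs p ?_)
      rw [Set.mem_Icc, ← abs_le] at hne
      exact not_le.1 hne
    refine ⟨C ^ L * ∫ t, ‖iteratedDeriv p ψ t‖, fun x => ?_⟩
    rw [convolution_eq_swap, ← Real.norm_eq_abs]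
    calc _ ≤ ∫ t, C ^ L * v x ^ (L * L) * ‖iteratedDeriv p ψ t‖ := by
          refine norm_integral_le_of_norm_le
            ((hpc.integrable_of_hasCompactSupport hsupp).norm.const_mul _)
            (Filter.Eventually.of_forall fun t => ?_)
          rw [ContinuousLinearMap.mul_apply', norm_mul]
          by_cases ht : 1 < |t|
          · rw [iteratedDeriv_eq_zero_of_one_lt hψs p ht]
            simp
          · refine mul_le_mul_of_nonneg_right ?_ (norm_nonneg _)
            rw [Real.norm_of_nonneg (pow_nonneg (hv0 _).le L), sub_eq_add_neg, pow_mul, ← mul_pow]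
            exact pow_le_pow_left₀ (hv0 _).le (hL x (-t) (by rw [abs_neg]; exact not_lt.1 ht)) L
      _ = _ := by rw [integral_const_mul]; ring
  · rw [convolution_eq_swap]
    calc v x = ∫ t, v x * ψ t := by rw [integral_const_mul, hψ1, mul_one]
      _ ≤ ∫ t, C * (v (x - t) ^ L * ψ t) := by
          refine integral_mono
            ((hψ.continuous.integrable_of_hasCompactSupport hψc).const_mul _)
            (((((hvc.comp (continuous_const.sub continuous_id)).pow L).mul
              hψ.continuous).integrable_of_hasCompactSupport hψc.mul_left).const_mul _)
            fun t => ?_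
          by_cases ht : ψ t = 0
          · simp [ht]
          · rw [← mul_assoc]
            refine mul_le_mul_of_nonneg_right ?_ (hψ0 t)
            simpa using hL (x - t) t (hψs t ht).le
      _ = _ := by rw [integral_const_mul]; rfl

/-! ### Rapidly decaying test functions -/

/-- A smooth bump function that is supported in the unit ball. -/
theorem exists_bump : ∃ ψ : ℝ → ℝ, ContDiff ℝ ∞ ψ ∧ (∀ x, 0 ≤ ψ x) ∧
    (∀ x, ψ x ≠ 0 → |x| < 1) ∧ ψ 0 = 1 := by
  let b : ContDiffBump (0 : ℝ) := ⟨1 / 2, 1, by norm_num, by norm_num⟩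
  refine ⟨b, b.contDiff, fun x => b.nonneg, fun x hx => ?_,
    b.one_of_mem_closedBall (by simp [b])⟩
  have : x ∈ Function.support b := hx
  rw [b.support_eq] at this
  simpa using this

theorem exists_abs_iteratedDeriv_bump_le {ψ : ℝ → ℝ} (hψ : ContDiff ℝ ∞ ψ)
    (hψs : ∀ x, ψ x ≠ 0 → |x| < 1) (p : ℕ) : ∃ A : ℝ, 0 ≤ A ∧ ∀ x, |iteratedDeriv p ψ x| ≤ A := by
  obtain ⟨A, hA⟩ := (isCompact_Icc (a := (-1 : ℝ)) (b := 1)).exists_bound_of_continuousOn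
    (hψ.continuous_iteratedDeriv p (by exact_mod_cast le_top)).continuousOn
  refine ⟨max A 0, le_max_right _ _, fun x => ?_⟩
  by_cases hx : 1 < |x|
  · rw [iteratedDeriv_eq_zero_of_one_lt hψs p hx, abs_zero]
    exact le_max_right _ _
  · exact (hA x (abs_le.1 (not_lt.1 hx))).trans (le_max_left _ _)

/-- A rapidly decaying smooth function that is not too small at given points. -/
theorem exists_rapidDecay_ge {v : ℝ → ℝ} (hv : ∀ x, 1 ≤ v x) {L : ℕ} {C : ℝ}
    (hC : 1 ≤ C) (hL : ∀ x t : ℝ, |t| ≤ 1 → v (x + t) ≤ C * v x ^ L) (y : ℕ → ℝ) :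
    ∃ f : ℝ → ℝ, SmoothIn (rapidDecay v) f ∧ (∀ x, 0 ≤ f x) ∧
      ∀ n : ℕ, (2 ^ n * v (y n) ^ (L * n))⁻¹ ≤ f (y n) := by
  obtain ⟨ψ, hψ, hψ0, hψs, hψ1⟩ := exists_bump
  choose A hA0 hA using exists_abs_iteratedDeriv_bump_le hψ hψs
  have hv0 x : 0 < v x := one_pos.trans_le (hv x)
  have hC0 : 0 < C := one_pos.trans_le hC
  -- The factor `2 ^ n` makes the series of bumps converge wherever the points `y n` lie; the power
  -- of `v (y n)`, growing with `n`, provides the decay.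
  let c : ℕ → ℝ := fun n => (2 ^ n * v (y n) ^ (L * n))⁻¹
  have hc0 n : 0 ≤ c n := inv_nonneg.2 (mul_nonneg (by positivity) (pow_nonneg (hv0 _).le _))
  have hc n : c n = (1 / 2) ^ n * (v (y n) ^ (L * n))⁻¹ := by
    simp only [c, mul_inv, one_div, inv_pow]
  let g : ℕ → ℝ → ℝ := fun n x => c n * ψ (x - y n)
  have hg n : ContDiff ℝ ∞ (g n) := contDiff_const.mul (hψ.comp (contDiff_id.sub contDiff_const))
  have hgd p n x : ‖iteratedFDeriv ℝ p (g n) x‖ = c n * |iteratedDeriv p ψ (x - y n)| := by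
    rw [norm_iteratedFDeriv_eq_norm_iteratedDeriv, iteratedDeriv_const_mul_field,
      iteratedDeriv_comp_sub_const, norm_mul, Real.norm_of_nonneg (hc0 n), Real.norm_eq_abs]
  have hgle p n x : ‖iteratedFDeriv ℝ p (g n) x‖ ≤ (1 / 2) ^ n * A p := by
    rw [hgd, hc]
    refine mul_le_mul (mul_le_of_le_one_right (by positivity) ?_) (hA p _) (abs_nonneg _)
      (by positivity)
    exact inv_le_one_of_one_le₀ (one_le_pow₀ (hv _))
  have hsum p : Summable fun n : ℕ => (1 / 2 : ℝ) ^ n * A p := summable_geometric_two.mul_right _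
  have hsmooth : ContDiff ℝ ∞ fun x => ∑' n, g n x :=
    contDiff_tsum (N := ⊤) hg (fun p _ => hsum p) fun p n x _ => hgle p n x
  refine ⟨fun x => ∑' n, g n x, ⟨hsmooth, fun p => mem_rapidDecay.2 fun N => ?_⟩,
    fun x => tsum_nonneg fun n => mul_nonneg (hc0 n) (hψ0 _), fun n => ?_⟩
  -- On the `n`-th bump `v x ^ N` is at most `C ^ N * v (y n) ^ (L * N)`. The coefficient `c n`
  -- absorbs this for `n ≥ N`, and `D` takes care of the finitely many smaller `n`.
  · let D : ℝ := 1 + ∑ n ∈ Finset.range N, v (y n) ^ (L * N)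
    have hD n : v (y n) ^ (L * N) ≤ D * v (y n) ^ (L * n) := by
      have h1 : 1 ≤ v (y n) ^ (L * n) := one_le_pow₀ (hv _)
      have hs : 0 ≤ ∑ n ∈ Finset.range N, v (y n) ^ (L * N) :=
        Finset.sum_nonneg fun n _ => pow_nonneg (hv0 _).le _
      rcases lt_or_ge n N with hn | hn
      · refine le_trans ?_ (le_mul_of_one_le_right (by positivity) h1)
        exact (Finset.single_le_sum (f := fun n => v (y n) ^ (L * N))
          (fun n _ => pow_nonneg (hv0 _).le _) (Finset.mem_range.2 hn)).trans (by simp [D])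
      · exact (pow_le_pow_right₀ (hv _) (Nat.mul_le_mul_left L hn)).trans
          (le_mul_of_one_le_left (by positivity) (by simp only [D]; linarith))
    refine ⟨2 * (A p * (C ^ N * D)), fun x => ?_⟩
    rw [← Real.norm_eq_abs, ← norm_iteratedFDeriv_eq_norm_iteratedDeriv,
      iteratedFDeriv_tsum_apply (N := ⊤) hg (fun p _ => hsum p) (fun p n x _ => hgle p n x) le_top,
      mul_assoc]
    refine tsum_of_norm_bounded (hasSum_geometric_two.mul_right _) fun n => ?_
    rw [hgd, hc, mul_assoc]
    refine mul_le_mul_of_nonneg_left ?_ (by positivity)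
    have hvx : 0 < v x ^ N := pow_pos (hv0 x) N
    have hvy : 0 < v (y n) ^ (L * n) := pow_pos (hv0 _) _
    by_cases hx : 1 < |x - y n|
    · rw [iteratedDeriv_eq_zero_of_one_lt hψs p hx, abs_zero, mul_zero]
      have : 0 ≤ D := add_nonneg zero_le_one
        (Finset.sum_nonneg fun n _ => pow_nonneg (hv0 _).le _)
      have := hA0 p
      positivity
    · have h1 : v x ^ N ≤ C ^ N * D * v (y n) ^ (L * n) := by
        have := hL (y n) (x - y n) (not_lt.1 hx)
        rw [add_sub_cancel] at this
        calc v x ^ N ≤ (C * v (y n) ^ L) ^ N := pow_le_pow_left₀ (hv0 x).le this N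
          _ = C ^ N * v (y n) ^ (L * N) := by rw [mul_pow, pow_mul]
          _ ≤ C ^ N * (D * v (y n) ^ (L * n)) :=
              mul_le_mul_of_nonneg_left (hD n) (by positivity)
          _ = _ := by ring
      have h2 : (v (y n) ^ (L * n))⁻¹ ≤ C ^ N * D * (v x ^ N)⁻¹ := by
        rw [← div_eq_mul_inv, le_div_iff₀ hvx, inv_mul_le_iff₀ hvy]
        linarith
      calc _ ≤ C ^ N * D * (v x ^ N)⁻¹ * A p :=
            mul_le_mul h2 (hA p _) (abs_nonneg _) ((inv_nonneg.2 hvy.le).trans h2)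
        _ = _ := by ring
  · have hs : Summable fun m => g m (y n) := by
      refine Summable.of_norm_bounded (hsum 0) fun m => ?_
      simpa using hgle 0 m (y n)
    refine le_trans ?_ (hs.le_tsum n fun m _ => mul_nonneg (hc0 m) (hψ0 _))
    simp [g, c, hψ1]

/-- If products of `h` with the composites of rapidly decaying functions with `φ` are bounded,
then `h` has at most polynomial growth with respect to the composite of the weight with `φ`. -/
theorem exists_le_of_rapidDecay {v : ℝ → ℝ} (hv : ∀ x, 1 ≤ v x) {L : ℕ} {C : ℝ}
    (hC : 1 ≤ C) (hL : ∀ x t : ℝ, |t| ≤ 1 → v (x + t) ≤ C * v x ^ L) {φ h : ℝ → ℝ} (a : ℕ)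
    (H : ∀ f : ℝ → ℝ, SmoothIn (rapidDecay v) f →
      ∃ B : ℝ, ∀ x, |f (φ x) ^ a * h x| ≤ B) :
    ∃ N : ℕ, ∃ B : ℝ, ∀ x, |h x| ≤ B * v (φ x) ^ N := by
  by_contra! hcon
  -- The constants are the `a`-th power of the reciprocal of the lower bound for `f` in
  -- `exists_rapidDecay_ge`, times `n`, so that `|f (φ (x n)) ^ a * h (x n)| > n`.
  choose x hx using fun n : ℕ => hcon (L * n * a) (n * 2 ^ (n * a))
  obtain ⟨f, hf, hf0, hfx⟩ := exists_rapidDecay_ge hv hC hL fun n => φ (x n)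
  obtain ⟨B, hB⟩ := H f hf
  obtain ⟨n, hn⟩ := exists_nat_gt B
  have hq : 0 < 2 ^ n * v (φ (x n)) ^ (L * n) :=
    mul_pos (by positivity) (pow_pos (one_pos.trans_le (hv _)) _)
  have h1 : (n : ℝ) * (2 ^ n * v (φ (x n)) ^ (L * n)) ^ a < |h (x n)| := by
    refine (hx n).trans_eq' ?_
    rw [mul_pow, ← pow_mul, ← pow_mul, mul_assoc]
  have h2 : ((2 ^ n * v (φ (x n)) ^ (L * n)) ^ a)⁻¹ ≤ f (φ (x n)) ^ a := by
    rw [← inv_pow]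
    exact pow_le_pow_left₀ (inv_nonneg.2 hq.le) (hfx n) a
  have h3 := hB (x n)
  rw [abs_mul, abs_of_nonneg (pow_nonneg (hf0 _) a)] at h3
  have h4 := (mul_le_mul_of_nonneg_right h2 (abs_nonneg (h (x n)))).trans h3
  rw [inv_mul_le_iff₀ (pow_pos hq a)] at h4
  have h5 := h1.trans_le h4
  rw [mul_comm] at h5
  exact lt_asymm hn (lt_of_mul_lt_mul_left h5 (pow_pos hq a).le)

variable {𝕜 : Type*} [RCLike 𝕜]

/-! ### Real functions as elements of the function spaces -/

variable (𝕜) in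
/-- A real function, regarded as a `𝕜`-valued function. -/
def ofReal (g : ℝ → ℝ) : Fun 𝕜 := ⟨fun x => (g x : 𝕜)⟩

theorem norm_iteratedDeriv_ofReal {g : ℝ → ℝ} (hg : ContDiff ℝ ∞ g) (p : ℕ) (x : ℝ) :
    ‖iteratedDeriv p (ofReal 𝕜 g) x‖ = |iteratedDeriv p g x| := by
  rw [← Real.norm_eq_abs, ← norm_iteratedFDeriv_eq_norm_iteratedDeriv,
    ← norm_iteratedFDeriv_eq_norm_iteratedDeriv]
  exact (RCLike.ofRealLI (K := 𝕜)).norm_iteratedFDeriv_comp_left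
    (hg.of_le (by exact_mod_cast le_top)).contDiffAt le_rfl

theorem bddAbove_range_div_iff {h : ℝ → 𝕜} {u : Weight} :
    BddAbove (Set.range fun x : ℝ => ‖h x‖ / u x) ↔ ∃ C : ℝ, ∀ x, ‖h x‖ ≤ C * u x := by
  simp only [BddAbove, Set.Nonempty, mem_upperBounds, Set.forall_mem_range]
  exact exists_congr fun C => forall_congr' fun x => div_le_iff₀ (u.pos x)

theorem ofReal_mem_B {g : ℝ → ℝ} (hg : ContDiff ℝ ∞ g) {n : ℕ} {u : Weight} :
    ofReal 𝕜 g ∈ B 𝕜 n u ↔ ∀ p ≤ n, iteratedDeriv p g ∈ dominated u := by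
  have hg' : ContDiff ℝ n (ofReal 𝕜 g) :=
    (RCLike.ofRealCLM (K := 𝕜)).contDiff.comp (hg.of_le (by exact_mod_cast le_top))
  rw [mem_B, and_iff_right hg']
  refine forall₂_congr fun p _ => ?_
  rw [bddAbove_range_div_iff, mem_dominated]
  simp only [norm_iteratedDeriv_ofReal hg]

theorem compOp_ofReal (φ g : ℝ → ℝ) :
    compOp 𝕜 φ (ofReal 𝕜 g) = ofReal 𝕜 fun x => g (φ x) := rfl

theorem ofReal_mem_K {v : Weight} {g : ℝ → ℝ} (hg : SmoothIn (rapidDecay v) g) :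
    ofReal 𝕜 g ∈ K 𝕜 v :=
  mem_K.2 fun N => (ofReal_mem_B hg.1).2 fun p _ => mem_rapidDecay.1 (hg.2 p) N

theorem mem_dominated_of_ofReal_mem_K {v : Weight} {g : ℝ → ℝ} (hg : ContDiff ℝ ∞ g)
    (h : ofReal 𝕜 g ∈ K 𝕜 v) {p N : ℕ} (hp : p ≤ N) :
    iteratedDeriv p g ∈ dominated fun x => (v x ^ N)⁻¹ :=
  (ofReal_mem_B hg).1 (mem_K.1 h N) p hp

theorem smoothIn_of_ofReal_mem_K {v : Weight} (hv : ∀ x, 1 ≤ v x) {g : ℝ → ℝ}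
    (hg : ContDiff ℝ ∞ g) (h : ofReal 𝕜 g ∈ K 𝕜 v) : SmoothIn (dominated fun _ => 1) g :=
  ⟨hg, fun p => dominated_mono (fun x => inv_pos.2 (pow_pos (v.pos x) p))
    (fun x => inv_le_one_of_one_le₀ (one_le_pow₀ (hv x))) (mem_dominated_of_ofReal_mem_K hg h le_rfl)⟩

theorem ofReal_mem_OC {v : Weight} (hv : ∀ x, 1 ≤ v x) {g : ℝ → ℝ} (hg : ContDiff ℝ ∞ g) :
    ofReal 𝕜 g ∈ OC 𝕜 v ↔ ∃ N : ℕ, SmoothIn (dominated fun x => v x ^ N) g := by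
  rw [mem_OC hv]
  refine exists_congr fun N => ⟨fun h => ⟨hg, fun p => (ofReal_mem_B hg).1 (h p) p le_rfl⟩,
    fun h n => (ofReal_mem_B hg).2 fun p _ => h.2 p⟩

theorem smoothIn_of_ofReal_mem_OM {v : Weight} (hv : ∀ x, 1 ≤ v x) {g : ℝ → ℝ}
    (hg : ContDiff ℝ ∞ g) (h : ofReal 𝕜 g ∈ OM 𝕜 v) : SmoothIn (polynomialGrowth v) g := by
  refine ⟨hg, fun p => (mem_polynomialGrowth hv).2 ?_⟩
  obtain ⟨N, hN⟩ := (mem_OM hv).1 h p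
  exact ⟨N, (ofReal_mem_B hg).1 hN p le_rfl⟩

theorem OC_le_OM {v : Weight} (hv : ∀ x, 1 ≤ v x) : OC 𝕜 v ≤ OM 𝕜 v := fun f hf => by
  obtain ⟨N, hN⟩ := (mem_OC hv).1 hf
  exact (mem_OM hv).2 fun n => ⟨N, hN n⟩

theorem ofReal_mem_OC_of_bounded {v : Weight} (hv : ∀ x, 1 ≤ v x) {g : ℝ → ℝ}
    (hg : SmoothIn (dominated fun _ => 1) g) : ofReal 𝕜 g ∈ OC 𝕜 v :=
  (ofReal_mem_OC hv hg.1).2 ⟨0, by simpa only [pow_zero] using hg⟩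

/-! ### Continuity of composition operators -/

section Limits

variable {φ : ℝ → ℝ} {ι κ : Type} {X : ι → Submodule 𝕜 (Fun 𝕜)} [∀ i, TopologicalSpace (X i)]
  {Y : κ → Submodule 𝕜 (Fun 𝕜)} [∀ i, TopologicalSpace (Y i)]
  {Z : Submodule 𝕜 (Fun 𝕜)} [TopologicalSpace Z]

theorem CompContinuous.to_iInf (h : ∀ i, CompContinuous φ Z (X i)) :
    letI := projTopology X
    CompContinuous φ Z (⨅ i, X i) := by
  let := projTopology X
  refine ⟨fun f hf => (Submodule.mem_iInf _).2 fun i => (h i).1 f hf, ?_⟩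
  refine continuous_iInf_rng.2 fun i => continuous_induced_rng.2 ?_
  exact (h i).2

theorem CompContinuous.from_iInf (i : ι) (h : CompContinuous φ (X i) Z) :
    letI := projTopology X
    CompContinuous φ (⨅ i, X i) Z := by
  let := projTopology X
  refine ⟨fun f hf => h.1 f ((Submodule.mem_iInf _).1 hf i), ?_⟩
  have hi : Continuous (Submodule.inclusion (iInf_le X i)) :=
    continuous_iff_le_induced.2 (iInf_le _ i)
  exact h.2.comp hi

theorem continuous_inclusion_iSup (i : ι) :
    letI := indTopology X
    Continuous (Submodule.inclusion (le_iSup X i)) :=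
  continuous_sInf_rng.2 fun _ ht => ht.1 i

-- This and the next two lemmas show that the infimum defining `indTopology` is itself a locally
-- convex vector space topology, so an inductive limit can be the target in
-- `CompContinuous.from_iSup`.
variable (X) in
theorem isTopologicalAddGroup_indTopology :
    letI := indTopology X
    IsTopologicalAddGroup (⨆ i, X i : Submodule 𝕜 (Fun 𝕜)) :=
  topologicalAddGroup_sInf fun _ ht => ht.2.1

variable (X) in
theorem continuousSMul_indTopology :
    letI := indTopology X
    ContinuousSMul 𝕜 (⨆ i, X i : Submodule 𝕜 (Fun 𝕜)) :=
  continuousSMul_sInf fun _ ht => ht.2.2.1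

variable (X) in
theorem locallyConvexSpace_indTopology :
    letI := indTopology X
    LocallyConvexSpace ℝ (⨆ i, X i : Submodule 𝕜 (Fun 𝕜)) :=
  LocallyConvexSpace.sInf fun _ ht => ht.2.2.2

theorem CompContinuous.to_iSup (i : ι) (h : CompContinuous φ Z (X i)) :
    letI := indTopology X
    CompContinuous φ Z (⨆ i, X i) := by
  let := indTopology X
  refine ⟨fun f hf => le_iSup X i (h.1 f hf), ?_⟩
  exact (continuous_inclusion_iSup i).comp h.2

/-- The topology induced by `C_φ` from `Z` is one of the competitors in the infimum defining
`indTopology`, hence is coarser than it. -/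
theorem CompContinuous.from_iSup [IsTopologicalAddGroup Z] [ContinuousSMul 𝕜 Z]
    [LocallyConvexSpace ℝ Z] (h : ∀ i, CompContinuous φ (X i) Z) :
    letI := indTopology X
    CompContinuous φ (⨆ i, X i) Z := by
  let := indTopology X
  have hle : ⨆ i, X i ≤ Z.comap (compOp 𝕜 φ) := iSup_le fun i f hf => (h i).1 f hf
  refine ⟨hle, ?_⟩
  let T : (⨆ i, X i : Submodule 𝕜 (Fun 𝕜)) →ₗ[𝕜] Z := (compOp 𝕜 φ).restrict hle
  refine continuous_iff_le_induced.2 (sInf_le ⟨fun i => continuous_induced_rng.2 (h i).2,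
    topologicalAddGroup_induced T, continuousSMul_induced T,
    LocallyConvexSpace.induced (T.restrictScalars ℝ)⟩)

theorem CompContinuous.iSup_iSup (h : ∀ i, ∃ j, CompContinuous φ (X i) (Y j)) :
    letI := indTopology X
    letI := indTopology Y
    CompContinuous φ (⨆ i, X i) (⨆ i, Y i) := by
  let := indTopology Y
  have := isTopologicalAddGroup_indTopology Y
  have := continuousSMul_indTopology Y
  have := locallyConvexSpace_indTopology Y
  exact CompContinuous.from_iSup fun i => (h i).elim fun j hj => hj.to_iSup j

end Limits

/-- A criterion for the continuity of composition operators between the normed spaces. -/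
theorem compContinuous_B {φ : ℝ → ℝ} (hφ : ContDiff ℝ ∞ φ) {n m : ℕ} (hnm : n ≤ m) {u u' : Weight}
    {D : ℝ → ℝ} (hD1 : ∀ x, 1 ≤ D x)
    (hD : ∀ i, 1 ≤ i → i ≤ n → ∀ x, |iteratedDeriv i φ x| ≤ D x) {C : ℝ}
    (hC : ∀ x, u (φ x) * D x ^ n ≤ C * u' x) : CompContinuous φ (B 𝕜 m u) (B 𝕜 n u') := by
  have hC0 : 0 ≤ C := nonneg_of_mul_nonneg_left
    ((mul_nonneg (u.pos _).le (pow_nonneg (zero_le_one.trans (hD1 0)) n)).trans (hC 0)) (u'.pos 0)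
  have key (f : B 𝕜 m u) (p : ℕ) (hp : p ≤ n) (x : ℝ) :
      ‖iteratedDeriv p (compOp 𝕜 φ f.1) x‖ ≤ n.factorial * C * ‖f‖ * u' x := by
    have hpm : (p : WithTop ℕ∞) ≤ m := by exact_mod_cast hp.trans hnm
    have h1 := norm_iteratedFDeriv_comp_le (f.2.1.of_le hpm)
      (hφ.of_le (by exact_mod_cast le_top)) le_rfl x (C := ‖f‖ * u (φ x)) (D := D x)
      (fun i hi => by
        rw [norm_iteratedFDeriv_eq_norm_iteratedDeriv, ← div_le_iff₀ (u.pos _)]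
        exact le_bNorm f (hi.trans (hp.trans hnm)) (φ x))
      (fun i hi1 hi => by
        rw [norm_iteratedFDeriv_eq_norm_iteratedDeriv]
        -- The composition estimate asks for the bound `D x ^ i`; since `D x ≥ 1` and `i ≥ 1`, the
        -- bound `D x` is stronger.
        exact (hD i hi1 (hi.trans hp) x).trans (le_self_pow₀ (hD1 x) (by lia)))
    rw [norm_iteratedFDeriv_eq_norm_iteratedDeriv] at h1
    have hf : 0 ≤ ‖f‖ * u (φ x) := mul_nonneg (norm_nonneg f) (u.pos _).le
    have hfac : (p.factorial : ℝ) ≤ n.factorial := by exact_mod_cast Nat.factorial_le hp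
    calc _ ≤ p.factorial * (‖f‖ * u (φ x)) * D x ^ p := h1
      _ ≤ n.factorial * (‖f‖ * u (φ x)) * D x ^ n :=
          mul_le_mul (mul_le_mul_of_nonneg_right hfac hf) (pow_le_pow_right₀ (hD1 x) hp)
            (pow_nonneg (zero_le_one.trans (hD1 x)) p) (by positivity)
      _ = n.factorial * ‖f‖ * (u (φ x) * D x ^ n) := by ring
      _ ≤ n.factorial * ‖f‖ * (C * u' x) := mul_le_mul_of_nonneg_left (hC x) (by positivity)
      _ = _ := by ring
  have hmem : ∀ f ∈ B 𝕜 m u, compOp 𝕜 φ f ∈ B 𝕜 n u' := fun f hf =>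
    mem_B.2 ⟨(hf.1.of_le (by exact_mod_cast hnm)).comp (hφ.of_le (by exact_mod_cast le_top)),
      fun p hp => bddAbove_range_div_iff.2 ⟨_, key ⟨f, hf⟩ p hp⟩⟩
  refine ⟨hmem, AddMonoidHomClass.continuous_of_bound ((compOp 𝕜 φ).restrict hmem)
    (n.factorial * C) fun f => bNorm_le _ fun p hp x => ?_⟩
  rw [div_le_iff₀ (u'.pos x)]
  exact key f p hp x

theorem exists_uniform_bound {h : ℕ → ℝ → ℝ} {u : ℝ → ℝ} (hu : ∀ x, 0 < u x) (n : ℕ)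
    (H : ∀ i, 1 ≤ i → i ≤ n → ∃ C : ℝ, ∀ x, |h i x| ≤ C * u x) :
    ∃ C : ℝ, 1 ≤ C ∧ ∀ i, 1 ≤ i → i ≤ n → ∀ x, |h i x| ≤ C * u x := by
  induction n with
  | zero => exact ⟨1, le_rfl, fun i h1 h2 => absurd (h1.trans h2) (by decide)⟩
  | succ n ih =>
    obtain ⟨C, hC1, hC⟩ := ih fun i h1 h2 => H i h1 (h2.trans n.le_succ)
    obtain ⟨C', hC'⟩ := H (n + 1) (Nat.le_add_left 1 n) le_rfl
    refine ⟨max C C', hC1.trans (le_max_left _ _), fun i h1 h2 x => ?_⟩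
    rcases h2.lt_or_eq with h2 | rfl
    · exact (hC i h1 (Nat.lt_succ_iff.1 h2) x).trans
        (mul_le_mul_of_nonneg_right (le_max_left _ _) (hu x).le)
    · exact (hC' x).trans (mul_le_mul_of_nonneg_right (le_max_right _ _) (hu x).le)

theorem exists_uniform_pow_bound {h : ℕ → ℝ → ℝ} {u : ℝ → ℝ} (hu : ∀ x, 1 ≤ u x) (n : ℕ)
    (H : ∀ i, 0 < i → ∃ N : ℕ, ∃ C : ℝ, ∀ x, |h i x| ≤ C * u x ^ N) :
    ∃ N : ℕ, ∃ C : ℝ, 1 ≤ C ∧ ∀ i, 1 ≤ i → i ≤ n → ∀ x, |h i x| ≤ C * u x ^ N := by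
  choose! N hN using H
  have hu0 x : 0 < u x := one_pos.trans_le (hu x)
  refine ⟨∑ i ∈ Finset.range (n + 1), N i,
    exists_uniform_bound (fun x => pow_pos (hu0 x) _) n fun i h1 h2 => ?_⟩
  refine dominated_mono (fun x => pow_pos (hu0 x) _) (fun x => ?_) (hN i h1)
  exact pow_le_pow_right₀ (hu x)
    (Finset.single_le_sum (fun _ _ => Nat.zero_le _) (Finset.mem_range.2 (Nat.lt_succ_of_le h2)))

/-! ### Sufficient conditions -/

section Sufficient

variable {v w : Weight} {φ : ℝ → ℝ}

theorem compContinuous_K (hv : ∀ x, 1 ≤ v x) (hφ : ContDiff ℝ ∞ φ)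
    (h0 : ∃ N : ℕ, ∃ C : ℝ, ∀ x, |w x| ≤ C * v (φ x) ^ N)
    (h : ∀ p, 0 < p → ∃ N : ℕ, ∃ C : ℝ, ∀ x, |iteratedDeriv p φ x| ≤ C * v (φ x) ^ N) :
    CompContinuous φ (K 𝕜 v) (K 𝕜 w) := by
  obtain ⟨a, A, hA⟩ := h0
  refine CompContinuous.to_iInf fun n => ?_
  obtain ⟨b, D, hD1, hD⟩ := exists_uniform_pow_bound (fun x => hv (φ x)) n h
  -- Of the decay of `f`, `a * n` powers turn into decay in `w` and `b * n` pay for the derivatives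
  -- of `φ`. The remaining `n` secures enough differentiability, since order and decay share one
  -- index.
  refine CompContinuous.from_iInf (n + a * n + b * n) (compContinuous_B hφ (by lia)
    (D := fun x => D * v (φ x) ^ b) (fun x => one_le_mul_of_one_le_of_one_le hD1
      (one_le_pow₀ (hv _))) hD (C := A ^ n * D ^ n) fun x => ?_)
  have hvx : 0 < v (φ x) := v.pos _
  have hwx : 0 < w x ^ n := pow_pos (w.pos x) n
  have hwn : w x ^ n ≤ A ^ n * v (φ x) ^ (a * n) := by
    rw [pow_mul, ← mul_pow]
    exact pow_le_pow_left₀ (w.pos x).le ((le_abs_self _).trans (hA x)) n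
  change (v (φ x) ^ (n + a * n + b * n))⁻¹ * (D * v (φ x) ^ b) ^ n ≤ A ^ n * D ^ n * (w x ^ n)⁻¹
  rw [← div_eq_mul_inv (A ^ n * D ^ n), le_div_iff₀ hwx, mul_assoc, inv_mul_le_iff₀ (by positivity)]
  calc (D * v (φ x) ^ b) ^ n * w x ^ n
      ≤ (D * v (φ x) ^ b) ^ n * (A ^ n * v (φ x) ^ (a * n)) :=
        mul_le_mul_of_nonneg_left hwn (by positivity)
    _ = 1 * (v (φ x) ^ (a * n + b * n) * (A ^ n * D ^ n)) := by ring
    _ ≤ v (φ x) ^ n * (v (φ x) ^ (a * n + b * n) * (A ^ n * D ^ n)) := by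
        refine mul_le_mul_of_nonneg_right (one_le_pow₀ (hv _)) ?_
        have : 0 ≤ A ^ n := nonneg_of_mul_nonneg_left (hwx.le.trans hwn) (by positivity)
        positivity
    _ = _ := by ring

theorem compContinuous_OC (hw : ∀ x, 1 ≤ w x) (hφ : ContDiff ℝ ∞ φ)
    (h0 : ∃ N : ℕ, ∃ C : ℝ, ∀ x, |v (φ x)| ≤ C * w x ^ N)
    (h : ∀ p, 0 < p → iteratedDeriv p φ ∈ subpolynomialGrowth w) :
    CompContinuous φ (OC 𝕜 v) (OC 𝕜 w) := by
  obtain ⟨a, A, hA⟩ := h0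
  -- The target index must not depend on `n`. Bounding the derivatives of `φ` by multiples of `w ^
  -- (1 / (n + 1))` keeps the cost of `n` of them below one power of `w`.
  refine CompContinuous.iSup_iSup fun N => ⟨a * N + 1, ?_⟩
  refine CompContinuous.to_iInf fun n => CompContinuous.from_iInf n ?_
  have hroot x : 1 ≤ w x ^ (1 / ((n : ℝ) + 1)) := Real.one_le_rpow (hw x) (by positivity)
  obtain ⟨D, hD1, hD⟩ := exists_uniform_bound (h := fun i => iteratedDeriv i φ)
    (fun x => one_pos.trans_le (hroot x)) n fun i hi _ => mem_subpolynomialGrowth.1 (h i hi) n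
  refine compContinuous_B hφ le_rfl (D := fun x => D * w x ^ (1 / ((n : ℝ) + 1)))
    (fun x => one_le_mul_of_one_le_of_one_le hD1 (hroot x)) hD (C := A ^ N * D ^ n) fun x => ?_
  have hvn : v (φ x) ^ N ≤ A ^ N * w x ^ (a * N) := by
    rw [pow_mul, ← mul_pow]
    exact pow_le_pow_left₀ (v.pos _).le ((le_abs_self _).trans (hA x)) N
  have hwn : (w x ^ (1 / ((n : ℝ) + 1))) ^ n ≤ w x := by
    rw [← Real.rpow_natCast, ← Real.rpow_mul (w.pos x).le]
    refine (Real.rpow_le_rpow_of_exponent_le (hw x) ?_).trans_eq (Real.rpow_one _)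
    rw [one_div_mul_eq_div, div_le_one (by positivity)]
    linarith
  change v (φ x) ^ N * (D * w x ^ (1 / ((n : ℝ) + 1))) ^ n ≤ A ^ N * D ^ n * w x ^ (a * N + 1)
  rw [mul_pow]
  calc _ ≤ A ^ N * w x ^ (a * N) * (D ^ n * w x) :=
        mul_le_mul hvn (mul_le_mul_of_nonneg_left hwn (by positivity))
          (mul_nonneg (by positivity) (pow_nonneg (zero_le_one.trans (hroot x)) n))
          ((pow_pos (v.pos _) N).le.trans hvn)
    _ = _ := by ring

theorem compContinuous_OM (hw : ∀ x, 1 ≤ w x) (hφ : ContDiff ℝ ∞ φ)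
    (h0 : ∃ N : ℕ, ∃ C : ℝ, ∀ x, |v (φ x)| ≤ C * w x ^ N)
    (h : ∀ p, 0 < p → ∃ N : ℕ, ∃ C : ℝ, ∀ x, |iteratedDeriv p φ x| ≤ C * w x ^ N) :
    CompContinuous φ (OM 𝕜 v) (OM 𝕜 w) := by
  obtain ⟨a, A, hA⟩ := h0
  refine CompContinuous.to_iInf fun n => CompContinuous.from_iInf n ?_
  obtain ⟨b, D, hD1, hD⟩ := exists_uniform_pow_bound hw n h
  -- Here `n` is fixed before `N`, so the index may depend on it.
  refine CompContinuous.iSup_iSup fun N => ⟨a * N + b * n, ?_⟩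
  refine compContinuous_B hφ le_rfl (D := fun x => D * w x ^ b)
    (fun x => one_le_mul_of_one_le_of_one_le hD1 (one_le_pow₀ (hw x))) hD
    (C := A ^ N * D ^ n) fun x => ?_
  have hwx : 0 < w x := w.pos x
  have hvn : v (φ x) ^ N ≤ A ^ N * w x ^ (a * N) := by
    rw [pow_mul, ← mul_pow]
    exact pow_le_pow_left₀ (v.pos _).le ((le_abs_self _).trans (hA x)) N
  change v (φ x) ^ N * (D * w x ^ b) ^ n ≤ A ^ N * D ^ n * w x ^ (a * N + b * n)
  calc _ ≤ A ^ N * w x ^ (a * N) * (D * w x ^ b) ^ n :=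
        mul_le_mul_of_nonneg_right hvn (by positivity)
    _ = _ := by ring

end Sufficient

/-! ### Necessary conditions -/

section Necessary

variable {v w : Weight} {φ : ℝ → ℝ}

theorem CompContinuous.map_le {X Y : Submodule 𝕜 (Fun 𝕜)} [TopologicalSpace X] [TopologicalSpace Y]
    (h : CompContinuous φ X Y) : X.map (compOp 𝕜 φ) ≤ Y :=
  Submodule.map_le_iff_le_comap.2 h.1

theorem exists_bounds_of_K (hv : ∀ x, 1 ≤ v x) (hw : ∀ x, 1 ≤ w x) {L : ℕ} {C : ℝ}
    (hC : 1 ≤ C) (hL : ∀ x t : ℝ, |t| ≤ 1 → v (x + t) ≤ C * v x ^ L) (hφ : ContDiff ℝ ∞ φ)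
    (h : (K 𝕜 v).map (compOp 𝕜 φ) ≤ K 𝕜 w) :
    (∃ N : ℕ, ∃ C : ℝ, ∀ x, |w x| ≤ C * v (φ x) ^ N) ∧
      ∀ p, 0 < p → ∃ N : ℕ, ∃ C : ℝ, ∀ x, |iteratedDeriv p φ x| ≤ C * v (φ x) ^ N := by
  have hcomp {f : ℝ → ℝ} (hf : SmoothIn (rapidDecay v) f) :
      ofReal 𝕜 (fun x => f (φ x)) ∈ K 𝕜 w := by
    rw [← compOp_ofReal]
    exact h (Submodule.mem_map_of_mem (ofReal_mem_K hf))
  have hbdd {f : ℝ → ℝ} (hf : SmoothIn (rapidDecay v) f) :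
      SmoothIn (dominated fun _ => 1) fun x => f (φ x) :=
    smoothIn_of_ofReal_mem_K hw (hf.1.comp hφ) (hcomp hf)
  refine ⟨exists_le_of_rapidDecay hv hC hL 1 fun f hf => ?_, fun p hp => ?_⟩
  -- With order `0` and decay `1`, membership of `f ∘ φ` in `K_w` says that `f (φ x) * w x` is
  -- bounded.
  · obtain ⟨B, hB⟩ := mem_dominated_of_ofReal_mem_K (hf.1.comp hφ) (hcomp hf) (p := 0) (N := 1)
      zero_le_one
    refine ⟨B, fun x => ?_⟩
    have := hB x
    beta_reduce at this
    rw [iteratedDeriv_zero, pow_one, ← div_eq_mul_inv, le_div_iff₀ (w.pos x)] at this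
    rwa [pow_one, abs_mul, abs_of_pos (w.pos x)]
  · obtain ⟨p, rfl⟩ := Nat.exists_eq_add_one.2 hp
    refine exists_le_of_rapidDecay hv hC hL (p + 2) fun f hf => ?_
    obtain ⟨B, hB⟩ := (SmoothIn.pow_mul_iteratedDeriv
      (fun f hf g hg => by simpa only [mul_one] using mul_mem_dominated hf hg) hφ (hbdd hf)
      (hbdd (hf.mul (fun f hf g hg => mul_mem_rapidDecay hf hg) smoothIn_sin))
      (hbdd (hf.mul (fun f hf g hg => mul_mem_rapidDecay hf hg) smoothIn_cos)) p).2 0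
    exact ⟨B, fun x => by simpa using hB x⟩

/-- The smallest source and the largest target are used, so that the lemma serves both (II) and
(III). -/
theorem exists_bound_of_OM (hv : ∀ x, 1 ≤ v x) (hw : ∀ x, 1 ≤ w x) {L : ℕ} {C : ℝ}
    (hC : 1 ≤ C) (hL : ∀ x t : ℝ, |t| ≤ 1 → v (x + t) ≤ C * v x ^ L) (hφ : ContDiff ℝ ∞ φ)
    (h : (OC 𝕜 v).map (compOp 𝕜 φ) ≤ OM 𝕜 w) :
    ∃ N : ℕ, ∃ C : ℝ, ∀ x, |v (φ x)| ≤ C * w x ^ N := by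
  obtain ⟨f, N, hf, hvf⟩ := exists_smoothIn_ge v.continuous_toFun hv hC hL
  have hfφ : ofReal 𝕜 (fun x => f (φ x)) ∈ OM 𝕜 w := by
    rw [← compOp_ofReal]
    exact h (Submodule.mem_map_of_mem ((ofReal_mem_OC hv hf.1).2 ⟨N, hf⟩))
  obtain ⟨M, B, hB⟩ := (mem_polynomialGrowth hw).1
    ((smoothIn_of_ofReal_mem_OM hw (hf.1.comp hφ) hfφ).2 0)
  refine ⟨M, C * B, fun x => ?_⟩
  rw [abs_of_pos (v.pos _), mul_assoc]
  refine (hvf _).trans (mul_le_mul_of_nonneg_left ?_ (zero_le_one.trans hC))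
  exact (le_abs_self _).trans (by simpa using hB x)

theorem iteratedDeriv_mem_of_sin_cos {P : Submodule ℝ (ℝ → ℝ)}
    (h : ∀ f ∈ P, ∀ g ∈ P, (fun x => f x * g x) ∈ P) (hφ : ContDiff ℝ ∞ φ)
    (h1 : SmoothIn P fun _ => 1) (hs : SmoothIn P fun x => Real.sin (φ x))
    (hc : SmoothIn P fun x => Real.cos (φ x)) {p : ℕ} (hp : 0 < p) : iteratedDeriv p φ ∈ P := by
  obtain ⟨p, rfl⟩ := Nat.exists_eq_add_one.2 hp
  simpa using (SmoothIn.pow_mul_iteratedDeriv h hφ h1 (by simpa using hs) (by simpa using hc) p).2 0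

/-- Membership in `O_{C,w}` provides one exponent `N` for all derivatives of `f ∘ φ`, which is what
the interpolation argument needs. -/
theorem iteratedDeriv_mem_of_OC (hv : ∀ x, 1 ≤ v x) (hw : ∀ x, 1 ≤ w x) {L : ℕ} {C : ℝ}
    (hL : ∀ x t : ℝ, |t| ≤ 1 → w (x + t) ≤ C * w x ^ L) (hφ : ContDiff ℝ ∞ φ)
    (h : (OC 𝕜 v).map (compOp 𝕜 φ) ≤ OC 𝕜 w) {p : ℕ} (hp : 0 < p) :
    iteratedDeriv p φ ∈ subpolynomialGrowth w := by
  have key {f : ℝ → ℝ} (hf : SmoothIn (dominated fun _ => 1) f) :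
      SmoothIn (subpolynomialGrowth w) fun x => f (φ x) := by
    have hfφ : ofReal 𝕜 (fun x => f (φ x)) ∈ OC 𝕜 w := by
      rw [← compOp_ofReal]
      exact h (Submodule.mem_map_of_mem (ofReal_mem_OC_of_bounded hv hf))
    obtain ⟨N, hN⟩ := (ofReal_mem_OC hw (hf.1.comp hφ)).1 hfφ
    obtain ⟨B, hB⟩ := hf.2 0
    exact smoothIn_subpolynomialGrowth hw hL ⟨B, fun x => by simpa using hB (φ x)⟩ hN
  exact iteratedDeriv_mem_of_sin_cos (fun f hf g hg => mul_mem_subpolynomialGrowth hw hf hg) hφ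
    (key (smoothIn_const 1)) (key smoothIn_sin) (key smoothIn_cos) hp

theorem iteratedDeriv_mem_of_OM (hv : ∀ x, 1 ≤ v x) (hw : ∀ x, 1 ≤ w x) (hφ : ContDiff ℝ ∞ φ)
    (h : (OM 𝕜 v).map (compOp 𝕜 φ) ≤ OM 𝕜 w) {p : ℕ} (hp : 0 < p) :
    iteratedDeriv p φ ∈ polynomialGrowth w := by
  have key {f : ℝ → ℝ} (hf : SmoothIn (dominated fun _ => 1) f) :
      SmoothIn (polynomialGrowth w) fun x => f (φ x) := by
    refine smoothIn_of_ofReal_mem_OM (𝕜 := 𝕜) hw (hf.1.comp hφ) ?_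
    rw [← compOp_ofReal]
    exact h (Submodule.mem_map_of_mem (OC_le_OM hv (ofReal_mem_OC_of_bounded hv hf)))
  exact iteratedDeriv_mem_of_sin_cos (fun f hf g hg => mul_mem_polynomialGrowth hw hf hg) hφ
    (key (smoothIn_const 1)) (key smoothIn_sin) (key smoothIn_cos) hp

end Necessary

/-! ### Translation to quotients with real exponents, and the three equivalences -/

theorem mem_subpolynomialGrowth_iff_div {w h : ℝ → ℝ} (hw : ∀ x, 1 ≤ w x) :
    h ∈ subpolynomialGrowth w ↔
      ∀ k : ℕ, 0 < k → ∃ C : ℝ, ∀ x, |h x| / w x ^ (1 / (k : ℝ)) ≤ C := by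
  have hdiv (k : ℕ) (C x : ℝ) : |h x| / w x ^ (1 / (k : ℝ)) ≤ C ↔
      |h x| ≤ C * w x ^ (1 / (k : ℝ)) :=
    div_le_iff₀ (Real.rpow_pos_of_pos (one_pos.trans_le (hw x)) _)
  simp only [hdiv, mem_subpolynomialGrowth]
  constructor
  · intro H k hk
    obtain ⟨k, rfl⟩ := Nat.exists_eq_add_one.2 hk
    simpa using H k
  · intro H k
    simpa using H (k + 1) k.succ_pos

end WeightedSmooth

end

theorem theorem1 {𝕜 : Type*} [RCLike 𝕜] (v w : WeightedSmooth.Weight)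
    (hv : ∀ x, 1 ≤ v x) (hw : ∀ x, 1 ≤ w x)
    (hv' : ∃ lam : ℝ, 0 < lam ∧ ∃ C : ℝ, ∀ x t : ℝ, |t| ≤ 1 → v (x + t) / v x ^ lam ≤ C)
    (hw' : ∃ mu : ℝ, 0 < mu ∧ ∃ C : ℝ, ∀ x t : ℝ, |t| ≤ 1 → w (x + t) / w x ^ mu ≤ C)
    (φ : ℝ → ℝ) (hφ : ContDiff ℝ ∞ φ) :
    List.TFAE [
      (WeightedSmooth.K 𝕜 v).map (WeightedSmooth.compOp 𝕜 φ) ≤ WeightedSmooth.K 𝕜 w,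
      WeightedSmooth.CompContinuous φ (WeightedSmooth.K 𝕜 v) (WeightedSmooth.K 𝕜 w),
      (∃ lam : ℝ, 0 < lam ∧ ∃ C : ℝ, ∀ x : ℝ, w x / v (φ x) ^ lam ≤ C) ∧
        (∀ p : ℕ, 0 < p → ∃ lam : ℝ, 0 < lam ∧
          ∃ C : ℝ, ∀ x : ℝ, |iteratedDeriv p φ x| / v (φ x) ^ lam ≤ C)] ∧
    List.TFAE [
      (WeightedSmooth.OC 𝕜 v).map (WeightedSmooth.compOp 𝕜 φ) ≤ WeightedSmooth.OC 𝕜 w,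
      WeightedSmooth.CompContinuous φ (WeightedSmooth.OC 𝕜 v) (WeightedSmooth.OC 𝕜 w),
      (∃ mu : ℝ, 0 < mu ∧ ∃ C : ℝ, ∀ x : ℝ, v (φ x) / w x ^ mu ≤ C) ∧
        (∀ p k : ℕ, 0 < p → 0 < k →
          ∃ C : ℝ, ∀ x : ℝ, |iteratedDeriv p φ x| / w x ^ (1 / (k : ℝ)) ≤ C)] ∧
    List.TFAE [
      (WeightedSmooth.OM 𝕜 v).map (WeightedSmooth.compOp 𝕜 φ) ≤ WeightedSmooth.OM 𝕜 w,
      WeightedSmooth.CompContinuous φ (WeightedSmooth.OM 𝕜 v) (WeightedSmooth.OM 𝕜 w),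
      (∃ mu : ℝ, 0 < mu ∧ ∃ C : ℝ, ∀ x : ℝ, v (φ x) / w x ^ mu ≤ C) ∧
        (∀ p : ℕ, 0 < p → ∃ mu : ℝ, 0 < mu ∧
          ∃ C : ℝ, ∀ x : ℝ, |iteratedDeriv p φ x| / w x ^ mu ≤ C)] := by
  obtain ⟨L, C, hC, hL⟩ := WeightedSmooth.exists_translate_le hv hv'
  obtain ⟨M, A, -, hM⟩ := WeightedSmooth.exists_translate_le hw hw'
  have hvw : (∃ mu : ℝ, 0 < mu ∧ ∃ C : ℝ, ∀ x : ℝ, v (φ x) / w x ^ mu ≤ C) ↔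
      ∃ N : ℕ, ∃ C : ℝ, ∀ x, |v (φ x)| ≤ C * w x ^ N := by
    simpa only [abs_of_pos (v.pos _)] using
      WeightedSmooth.exists_div_rpow_le_iff (h := fun x => v (φ x)) hw
  refine ⟨?_, ?_, ?_⟩
  · have hwv : (∃ lam : ℝ, 0 < lam ∧ ∃ C : ℝ, ∀ x : ℝ, w x / v (φ x) ^ lam ≤ C) ↔
        ∃ N : ℕ, ∃ C : ℝ, ∀ x, |w x| ≤ C * v (φ x) ^ N := by
      simpa only [abs_of_pos (w.pos _)] using
        WeightedSmooth.exists_div_rpow_le_iff (h := w) fun x => hv (φ x)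
    simp only [hwv, WeightedSmooth.exists_div_rpow_le_iff fun x => hv (φ x)]
    tfae_have 1 → 3 := WeightedSmooth.exists_bounds_of_K hv hw hC hL hφ
    tfae_have 3 → 2 := fun h => WeightedSmooth.compContinuous_K hv hφ h.1 h.2
    tfae_have 2 → 1 := WeightedSmooth.CompContinuous.map_le
    tfae_finish
  · have hsub : (∀ p k : ℕ, 0 < p → 0 < k →
        ∃ C : ℝ, ∀ x : ℝ, |iteratedDeriv p φ x| / w x ^ (1 / (k : ℝ)) ≤ C) ↔
        ∀ p, 0 < p → iteratedDeriv p φ ∈ WeightedSmooth.subpolynomialGrowth w := by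
      simp only [WeightedSmooth.mem_subpolynomialGrowth_iff_div hw]
      exact forall_congr' fun p => forall_comm
    rw [hvw, hsub]
    tfae_have 1 → 3 := fun h => ⟨WeightedSmooth.exists_bound_of_OM (𝕜 := 𝕜) hv hw hC hL hφ
      (h.trans (WeightedSmooth.OC_le_OM hw)),
      fun p hp => WeightedSmooth.iteratedDeriv_mem_of_OC hv hw hM hφ h hp⟩
    tfae_have 3 → 2 := fun h => WeightedSmooth.compContinuous_OC hw hφ h.1 h.2
    tfae_have 2 → 1 := WeightedSmooth.CompContinuous.map_le
    tfae_finish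
  · simp only [hvw, WeightedSmooth.exists_div_rpow_le_iff hw]
    tfae_have 1 → 3 := fun h => ⟨WeightedSmooth.exists_bound_of_OM (𝕜 := 𝕜) hv hw hC hL hφ
      ((Submodule.map_mono (WeightedSmooth.OC_le_OM hv)).trans h),
      fun p hp => (WeightedSmooth.mem_polynomialGrowth hw).1
        (WeightedSmooth.iteratedDeriv_mem_of_OM hv hw hφ h hp)⟩
    tfae_have 3 → 2 := fun h => WeightedSmooth.compContinuous_OM hw hφ h.1 h.2
    tfae_have 2 → 1 := WeightedSmooth.CompContinuous.map_le
    tfae_finish
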